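/- Let $\mathbf t=(\mathbf t^{(1)},\mathbf t^{(2)})$ with $\mathbf t^{(a)}=(t^{(a)}_1,t^{(a)}_2,\dots)$, let $\mathbb C((\mathbf t))$ be the field of fractions of $\mathbb C[[\mathbf t]]$, and let $\mathcal A$ be the ring of families $f=(f_n)_{n\in\mathbb Z}$ with $f_n\in\mathbb C((\mathbf t))$. Write $[w]=(w,w^2/2,w^3/3,\dots)$, let $\mathbf t\pm[w]_a$ denote $\mathbf t$ with $\mathbf t^{(a)}$ replaced by $\mathbf t^{(a)}\pm[w]$, and put $\xi(\mathbf x,z)=\sum_{k\ge1}x_kz^k$. Shifted arguments are understood through Taylor expansion; a second set of times is $\mathbf t'=\mathbf t+\mathbf s$ with formal $\mathbf s$, everything being expanded in $\mathbf s$. In the contour integrals below, $C_\infty$ and $C_0$ are circles around $z=\infty$ and $z=0$, the integrands are expanded in $z^{-1}$ and in $z$ respectively, and $\oint\frac{dz}{2\pi \mathbf i z}$ takes the coefficient of $z^0$. For integers $M,N\ge0$ and $f,g\in\mathcal A$ put $$\mathcal B_{M,N}(f,g)_{n,n'}=\oint_{C_\infty}\frac{dz}{2\pi \mathbf i z}z^{M+n-n'}f_n(\mathbf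 t-[z^{-1}]_1)g_{n'}(\mathbf t'+[z^{-1}]_1)e^{\xi(\mathbf t^{(1)}-\mathbf t'^{(1)},z)}+\oint_{C_0}\frac{dz}{2\pi \mathbf i z}z^{-N+n-n'+1}f_{n+1}(\mathbf t-[z]_2)g_{n'-1}(\mathbf t'+[z]_2)e^{\xi(\mathbf t^{(2)}-\mathbf t'^{(2)},z^{-1})}.$$ Let $M,N\ge1$ and $m\ge0$ be integers, let $\tau_0,\tau_1,\rho_i,\sigma_i\in\mathcal A$ ($1\le i\le m$) with $\tau_{0,n}\ne0$ and $\tau_{1,n}\neq0$ for all $n$, and suppose that they satisfy the bilinear equations of the generalized bigraded mToda (GBMT) hierarchy: for all $n,n'\in\mathbb Z$ and all $i$, $$\mathcal B_{M,N}(\tau_0,\tau_1)_{n,n'}=\sum_{i=1}^m\rho_{i,n}(\mathbf t)\sigma_{i,n'}(\mathbf t'),\qquad \mathcal B_{0,0}(\tau_0,\rho_i)_{n,n'}=\rho_{i,n}(\mathbf t)\tau_{0,n'}(\mathbf t'),$$ $$\mathcal B_{0,0}(\sigma_i,\tau_1)_{n,n'}=\tau_{1,n}(\mathbf t)\sigma_{i,n'}(\mathbf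 t'),\qquad \mathcal B_{0,0}(\tau_0,\tau_1)_{n,n'}=\tau_{1,n}(\mathbf t)\tau_{0,n'}(\mathbf t').$$ Let $\Lambda$ be the shift $n\mapsto n+1$, and consider formal operators $\sum_k a_k\Lambda^k$ with $a_k\in\mathcal A$, the product $a\Lambda^j\cdot b\Lambda^k=a\,\Lambda^j(b)\Lambda^{j+k}$ and the adjoint $(\sum_k a_k\Lambda^k)^*=\sum_k\Lambda^{-k}a_k$. Put $\Delta=\Lambda-1$, $\Delta^*=\Lambda^{-1}-1$, $\iota_\Lambda\Delta^{-1}=-\sum_{i\ge0}\Lambda^i$, $\iota_{\Lambda^{-1}}\Delta^{-1}=\sum_{i\ge1}\Lambda^{-i}$. For $A$ of order bounded above (resp. below) let $A_{\Delta,\ge1}$ (resp. $A_{\Delta^*,\ge1}$) be the part with powers $\ge1$ in the expansion of $A$ in powers of $\Delta$ (resp. $\Delta^*$). Define $$S_1=\sum_{k\ge0}\psi_{1,k}(n,\mathbf t)\Lambda^{-k},\qquad S_2=\sum_{k\ge0}\psi_{2,k}(n,\mathbf t)\Lambda^{k},$$ where $$\frac{\tau_{0,n}(\mathbf t-[z^{-1}]_1)}{\tau_{1,n}(\mathbf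 t)}=\sum_{k\ge0}\psi_{1,k}(n,\mathbf t)z^{-k},\qquad\frac{\tau_{0,n+1}(\mathbf t-[z]_2)}{\tau_{1,n}(\mathbf t)}=\sum_{k\ge0}\psi_{2,k}(n,\mathbf t)z^{k}.$$ Then $S_1$ is invertible among the operators of order bounded above and $S_2$ among those of order bounded below, the operators $$L_1=S_1\Lambda S_1^{-1},\qquad L_2=S_2\Lambda^{-1}S_2^{-1}$$ have the form $L_1=u\Lambda+\sum_{j\ge0}u_j\Lambda^{-j}$ and $L_2=\bar u\Lambda^{-1}+\sum_{j\ge0}\bar u_j\Lambda^j$, and together with $q_{i,n}=\rho_{i,n}/\tau_{1,n}$, $r_{i,n}=\sigma_{i,n}/\tau_{0,n}$ they satisfy, for all $a,b\in\{1,2\}$, $p\ge1$ and $1\le i\le m$: $$L_1^M\cdot\iota_{\Lambda^{-1}}\Delta^{-1}=L_2^N\cdot\iota_\Lambda\Delta^{-1}+\sum_{l\in\mathbb Z}\sum_{i=1}^m q_{i,n}\Lambda^l r_{i,n+1},$$ $$\partial_{t^{(a)}_p}L_b=[B^{(a)}_p,L_b],\qquad \partial_{t^{(a)}_p}q_{i,n}=B^{(a)}_p(q_{i,n}),\qquad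 \partial_{t^{(a)}_p}r_{i,n}=-\big(\Delta^{-1}B^{(a)*}_p\Delta\big)(r_{i,n}),$$ where $B^{(1)}_p=(L_1^p)_{\Delta,\ge1}$, $B^{(2)}_p=(L_2^p)_{\Delta^*,\ge1}$, and the last equation holds with either expansion $\iota_\Lambda\Delta^{-1}$ or $\iota_{\Lambda^{-1}}\Delta^{-1}$ in place of $\Delta^{-1}$. -/

import Mathlib

noncomputable section

namespace GBMT

/-! ## Time variables and the field of functions of the times -/

/-- Indices of the time variables: `(0, p)` is `t^{(1)}_p`, and `(1, p)` is `t^{(2)}_p`. -/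
abbrev Time : Type := Fin 2 × ℕ+

/-- `ℂ[[t]]`, formal power series in all the times `t^{(1)}_p, t^{(2)}_p`, `p ≥ 1`. -/
abbrev TimeSeries : Type := MvPowerSeries Time ℂ

/-- `ℂ((t))`, the field of fractions of `ℂ[[t]]`. -/
abbrev TimeField : Type := FractionRing TimeSeries

/-- The algebra map `f ↦ f + (∂f/∂t_i) ε` from `ℂ[[t]]` to the dual numbers over `ℂ((t))`. -/
def dualHom (i : Time) : TimeSeries →ₐ[ℂ] TrivSqZeroExt TimeField TimeField where
  toFun f := TrivSqZeroExt.inl (algebraMap TimeSeries TimeField f) +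
    TrivSqZeroExt.inr (algebraMap TimeSeries TimeField (MvPowerSeries.pderiv ℂ i f))
  map_one' := by
    apply TrivSqZeroExt.ext <;> simp
  map_mul' f g := by
    apply TrivSqZeroExt.ext
    · simp only [map_mul, TrivSqZeroExt.fst_add, TrivSqZeroExt.fst_mul, TrivSqZeroExt.fst_inl,
        TrivSqZeroExt.fst_inr, add_zero]
    · simp only [Derivation.leibniz, smul_eq_mul, map_add, map_mul, TrivSqZeroExt.snd_add,
        TrivSqZeroExt.snd_mul, TrivSqZeroExt.fst_add, TrivSqZeroExt.fst_inl,
        TrivSqZeroExt.fst_inr, TrivSqZeroExt.snd_inl, TrivSqZeroExt.snd_inr, add_zero, zero_add,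
        MulOpposite.smul_eq_mul_unop, MulOpposite.unop_op]
      rw [mul_comm (algebraMap TimeSeries TimeField g)]
  map_zero' := by
    apply TrivSqZeroExt.ext <;> simp
  map_add' f g := by
    apply TrivSqZeroExt.ext <;>
      simp only [map_add, TrivSqZeroExt.fst_add, TrivSqZeroExt.snd_add, TrivSqZeroExt.fst_inl,
        TrivSqZeroExt.fst_inr, TrivSqZeroExt.snd_inl, TrivSqZeroExt.snd_inr, add_zero, zero_add]
  commutes' c := by
    apply TrivSqZeroExt.ext
    · simp [TrivSqZeroExt.algebraMap_eq_inl', ← IsScalarTower.algebraMap_apply]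
    · simp [TrivSqZeroExt.algebraMap_eq_inl']

theorem dualHom_isUnit (i : Time) (y : nonZeroDivisors TimeSeries) :
    IsUnit (dualHom i (y : TimeSeries)) := by
  rw [TrivSqZeroExt.isUnit_iff_isUnit_fst]
  have h : (dualHom i (y : TimeSeries)).fst = algebraMap TimeSeries TimeField y := by
    simp [dualHom]
  rw [h]
  exact IsLocalization.map_units TimeField y

/-- The extension of `dualHom` to `ℂ((t))`. -/
def dualLift (i : Time) : TimeField →ₐ[ℂ] TrivSqZeroExt TimeField TimeField :=
  IsLocalization.liftAlgHom (M := nonZeroDivisors TimeSeries) (f := dualHom i) (dualHom_isUnit i)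

theorem dualLift_algebraMap (i : Time) (f : TimeSeries) :
    dualLift i (algebraMap TimeSeries TimeField f) = dualHom i f := by
  simp [dualLift, IsLocalization.liftAlgHom_apply]

theorem dualLift_fst (i : Time) (x : TimeField) : (dualLift i x).fst = x := by
  have h : ((TrivSqZeroExt.fstHom ℂ TimeField TimeField).comp (dualLift i)).toRingHom
      = RingHom.id TimeField := by
    apply IsLocalization.ringHom_ext (nonZeroDivisors TimeSeries)
    ext f : 1
    change (dualLift i (algebraMap TimeSeries TimeField f)).fst = algebraMap TimeSeries TimeField f
    rw [dualLift_algebraMap]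
    simp [dualHom]
  exact congrArg (fun φ : TimeField →+* TimeField => φ x) h

/-- The partial derivative `∂/∂t_i` on `ℂ((t))`: the extension of the partial derivative of
formal power series by the quotient rule. -/
def timeDeriv (i : Time) : Derivation ℂ TimeField TimeField where
  toFun x := (dualLift i x).snd
  map_add' x y := by simp
  map_smul' c x := by simp
  map_one_eq_zero' := by simp
  leibniz' x y := by simp [dualLift_fst, mul_comm]

theorem timeDeriv_algebraMap (i : Time) (f : TimeSeries) :
    timeDeriv i (algebraMap TimeSeries TimeField f) =
      algebraMap TimeSeries TimeField (MvPowerSeries.pderiv ℂ i f) := by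
  change (dualLift i (algebraMap TimeSeries TimeField f)).snd = _
  rw [dualLift_algebraMap]
  simp only [dualHom, AlgHom.coe_mk, RingHom.coe_mk, MonoidHom.coe_mk, OneHom.coe_mk,
    TrivSqZeroExt.snd_add, TrivSqZeroExt.snd_inl, TrivSqZeroExt.snd_inr, zero_add]

theorem pderiv_comm (i j : Time) (f : TimeSeries) :
    MvPowerSeries.pderiv ℂ i (MvPowerSeries.pderiv ℂ j f) =
      MvPowerSeries.pderiv ℂ j (MvPowerSeries.pderiv ℂ i f) := by
  ext d
  simp only [MvPowerSeries.coeff_pderiv]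
  by_cases h : i = j
  · subst h; rfl
  · have h' : j ≠ i := fun e => h e.symm
    simp only [Finsupp.add_apply, Finsupp.single_apply, h, h', if_false, add_zero,
      add_right_comm d (Finsupp.single i 1) (Finsupp.single j 1)]
    ring

theorem timeDeriv_comm (i j : Time) (x : TimeField) :
    timeDeriv i (timeDeriv j x) = timeDeriv j (timeDeriv i x) := by
  obtain ⟨f, g, hg, rfl⟩ := IsFractionRing.div_surjective (A := TimeSeries) x
  have hg0 : algebraMap TimeSeries TimeField g ≠ 0 :=
    IsLocalization.to_map_ne_zero_of_mem_nonZeroDivisors _ le_rfl hg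
  have h : ⁅timeDeriv i, timeDeriv j⁆ (algebraMap TimeSeries TimeField f /
      algebraMap TimeSeries TimeField g) = 0 := by
    have hz : ∀ f : TimeSeries, ⁅timeDeriv i, timeDeriv j⁆ (algebraMap TimeSeries TimeField f)
        = 0 := by
      intro f
      rw [Derivation.commutator_apply]
      simp only [timeDeriv_algebraMap, pderiv_comm i j f, sub_self]
    rw [Derivation.leibniz_div, hz, hz]
    simp
  rw [Derivation.commutator_apply, sub_eq_zero] at h
  exact h

instance timeDeriv_leftCommutative :
    LeftCommutative (fun (i : Time) (x : TimeField) => timeDeriv i x) :=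
  ⟨fun i j x => timeDeriv_comm i j x⟩

/-! ## Taylor expansions and shifted arguments -/

/-- The iterated partial derivative `∂^α f`. -/
def iterDeriv (α : Time →₀ ℕ) (f : TimeField) : TimeField :=
  (Finsupp.toMultiset α).foldr (fun i x => timeDeriv i x) f

/-- The Taylor series `f(t + s) = ∑_α (∂^α f)(t) s^α / α!`, a power series in new variables
`s^{(a)}_p` with coefficients in `ℂ((t))`. With a second set of times `t' = t + s`, this is
`f(t')`. -/
def taylor (f : TimeField) : MvPowerSeries Time TimeField :=
  fun α => (α.prod fun _ e => ((e.factorial : TimeField))⁻¹) * iterDeriv α f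

/-- The increments `s^{(a)}_p = ε w^p / p`, and `s^{(b)}_p = 0` for `b ≠ a`. -/
def increment (a : Fin 2) (ε : TimeField) (i : Time) : PowerSeries TimeField :=
  if i.1 = a then PowerSeries.monomial (i.2 : ℕ) (ε / ((i.2 : ℕ) : TimeField)) else 0

/-- `f(t + ε [w]_a)`, where `[w] = (w, w^2/2, w^3/3, …)` is added to the times `t^{(a)}`: a power
series in `w` with coefficients in `ℂ((t))`. -/
def shiftTime (a : Fin 2) (ε : TimeField) (f : TimeField) : PowerSeries TimeField :=
  MvPowerSeries.subst (increment a ε) (taylor f)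

/-- The substitution in `shiftTime` is legitimate. -/
theorem hasSubst_increment (a : Fin 2) (ε : TimeField) :
    MvPowerSeries.HasSubst (increment a ε) where
  const_coeff i := by
    have h : PowerSeries.constantCoeff (increment a ε i) = 0 := by
      unfold increment
      split_ifs
      · rw [← PowerSeries.coeff_zero_eq_constantCoeff_apply, PowerSeries.coeff_monomial,
          if_neg (fun h => i.2.ne_zero h.symm)]
      · simp
    have h' : MvPowerSeries.constantCoeff (increment a ε i) = 0 := h
    rw [h']
    exact IsNilpotent.zero
  coeff_zero d := by
    have hd : ∃ n : ℕ, d = Finsupp.single () n := ⟨d (), by ext; simp⟩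
    obtain ⟨n, rfl⟩ := hd
    have hsub : {i : Time | (increment a ε i).coeff n ≠ 0} ⊆
        {i : Time | (i.2 : ℕ) = n} := by
      intro i hi
      by_contra hne
      apply hi
      unfold increment
      split_ifs
      · rw [PowerSeries.coeff_monomial, if_neg (fun h => hne h.symm)]
      · simp
    refine Set.Finite.subset ?_ hsub
    refine Set.Finite.of_finite_image (f := fun i : Time => (i.1, (i.2 : ℕ))) ?_ ?_
    · refine Set.Finite.subset (Set.finite_univ.prod (Set.finite_singleton n)) ?_
      rintro _ ⟨i, hi, rfl⟩
      exact ⟨trivial, hi⟩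
    · rintro ⟨a, p⟩ _ ⟨b, q⟩ _ h
      simpa using h

/-! ## The bilinear equations

In both contour integrals the integrand is expanded in the local parameter `w` of the contour,
which is `w = z⁻¹` on `C_∞` and `w = z` on `C_0`. It is a power series in `s = t' - t` whose
coefficients are Laurent series in `w`; the integral against `dz/(2πiz)` is the coefficient
of `w^0`. -/

/-- Power series in `s` whose coefficients are Laurent series in the local parameter `w`. -/
abbrev Integrand : Type := MvPowerSeries Time (LaurentSeries TimeField)

/-- `f(t - [w]_a)`. -/
def factorAtT (a : Fin 2) (f : TimeField) : Integrand :=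
  MvPowerSeries.C (HahnSeries.ofPowerSeries ℤ TimeField (shiftTime a (-1) f))

/-- `g(t' + [w]_a)` with `t' = t + s`. -/
def factorAtT' (a : Fin 2) (g : TimeField) : Integrand :=
  fun α => HahnSeries.ofPowerSeries ℤ TimeField
    (PowerSeries.mk fun j =>
      MvPowerSeries.coeff α (taylor (PowerSeries.coeff j (shiftTime a 1 g))))

/-- `exp ξ(t^{(a)} - t'^{(a)}, w⁻¹) = exp (- ∑_p s^{(a)}_p w^{-p})`, expanded in `s`: the
coefficient of `s^α` is `∏_p (-w^{-p})^{α_p} / α_p!` if `s^α` involves only the variables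
`s^{(a)}_p`, and zero otherwise. -/
def expFactor (a : Fin 2) : Integrand :=
  fun α => α.prod fun i e =>
    if i.1 = a then HahnSeries.single (-((i.2 : ℤ) * (e : ℤ)))
      ((-1 : TimeField) ^ e * ((e.factorial : TimeField))⁻¹) else 0

/-- `∮ dz/(2πiz) w^k f(t - [w]_a) g(t' + [w]_a) exp ξ(t^{(a)} - t'^{(a)}, w⁻¹)`. -/
def contour (a : Fin 2) (k : ℤ) (f g : TimeField) : MvPowerSeries Time TimeField :=
  fun α => (MvPowerSeries.coeff α
    (MvPowerSeries.C (HahnSeries.single k (1 : TimeField)) *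
      factorAtT a f * factorAtT' a g * expFactor a)).coeff 0

/-- The left-hand side of the bilinear equations,
`∮_{C_∞} dz/(2πiz) z^{M+n-n'} f_n(t-[z⁻¹]_1) g_{n'}(t'+[z⁻¹]_1) e^{ξ(t^{(1)}-t'^{(1)},z)}
+ ∮_{C_0} dz/(2πiz) z^{-N+n-n'+1} f_{n+1}(t-[z]_2) g_{n'-1}(t'+[z]_2)
e^{ξ(t^{(2)}-t'^{(2)},z⁻¹)}`. -/
def bilinear (M N : ℕ) (f g : ℤ → TimeField) (n n' : ℤ) : MvPowerSeries Time TimeField :=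
  contour 0 (-((M : ℤ) + n - n')) (f n) (g n') +
    contour 1 (-(N : ℤ) + n - n' + 1) (f (n + 1)) (g (n' - 1))

/-- The product `f(t) g(t')`. -/
def twoPoint (f g : TimeField) : MvPowerSeries Time TimeField :=
  MvPowerSeries.C f * taylor g

/-- `(f, g)` is an mToda tau pair: the bilinear equation of the mToda hierarchy holds. -/
def IsTauPair (f g : ℤ → TimeField) : Prop :=
  ∀ n n' : ℤ, bilinear 0 0 f g n n' = twoPoint (g n) (f n')

/-- The bilinear equations of the generalized bigraded mToda hierarchy. -/
structure IsGBMT (m M N : ℕ) (τ₀ τ₁ : ℤ → TimeField) (ρ σ : Fin m → ℤ → TimeField) : Prop where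
  constraint : ∀ n n' : ℤ, bilinear M N τ₀ τ₁ n n' = ∑ i, twoPoint (ρ i n) (σ i n')
  pair_ρ : ∀ i, IsTauPair τ₀ (ρ i)
  pair_σ : ∀ i, IsTauPair (σ i) τ₁
  pair : IsTauPair τ₀ τ₁

/-! ## Formal shift operators -/

/-- Formal operators `A = ∑_{k ∈ ℤ} a_k(n) Λ^k`, infinite in both directions; `A k n` is
`a_k(n)`. -/
def ShiftOp : Type := ℤ → ℤ → TimeField

namespace ShiftOp

instance : AddCommGroup ShiftOp := inferInstanceAs (AddCommGroup (ℤ → ℤ → TimeField))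

/-- `Λ^j`. -/
def shift (j : ℤ) : ShiftOp := fun k _ => if k = j then 1 else 0

instance : One ShiftOp := ⟨shift 0⟩

/-- The product determined by `a Λ^j · b Λ^k = a Λ^j(b) Λ^{j+k}`, with `Λ^j(b)(n) = b(n + j)`.
It is meaningful when every coefficient of the product is a finite sum, as it is for operators
whose orders are all bounded on the same side, and when one factor has finitely many terms. -/
instance : Mul ShiftOp := ⟨fun A B k n => ∑ᶠ j : ℤ, A j n * B (k - j) (n + j)⟩

instance : Pow ShiftOp ℕ := ⟨fun A p => npowRec p A⟩

/-- The formal adjoint `(∑ a_k Λ^k)^* = ∑ Λ^{-k} a_k`. -/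
def adj (A : ShiftOp) : ShiftOp := fun k n => A (-k) (n + k)

/-- The action on a function of `n` (and the times). -/
def act (A : ShiftOp) (f : ℤ → TimeField) : ℤ → TimeField := fun n => ∑ᶠ k : ℤ, A k n * f (n + k)

/-- Differentiation of the coefficients with respect to the time `t_i`. -/
def deriv (i : Time) (A : ShiftOp) : ShiftOp := fun k n => timeDeriv i (A k n)

/-- `[A, B] = A B - B A`. -/
def comm (A B : ShiftOp) : ShiftOp := A * B - B * A

/-- `Δ = Λ - 1`. -/
def delta : ShiftOp := shift 1 - 1

/-- `Δ^* = Λ⁻¹ - 1`. -/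
def deltaStar : ShiftOp := shift (-1) - 1

/-- `ι_Λ Δ⁻¹ = - ∑_{i ≥ 0} Λ^i`. -/
def invDeltaUp : ShiftOp := fun k _ => if 0 ≤ k then -1 else 0

/-- `ι_{Λ⁻¹} Δ⁻¹ = ∑_{i ≥ 1} Λ^{-i}`. -/
def invDeltaDown : ShiftOp := fun k _ => if k ≤ -1 then 1 else 0

/-- `A` has order at most `d`: there are no terms in `Λ^k` with `k > d`. -/
def OrderLE (A : ShiftOp) (d : ℤ) : Prop := ∀ k n : ℤ, d < k → A k n = 0

/-- There are no terms in `Λ^k` with `k < d`. -/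
def OrderGE (A : ShiftOp) (d : ℤ) : Prop := ∀ k n : ℤ, k < d → A k n = 0

/-- `A_{Δ, ≥ 1}` for `A` of order bounded above. In the expansion of `A` in powers of `Δ`, where
`Λ^i = (1 + Δ)^i`, the coefficient of `Δ^j` with `j ≥ 1` is `∑_{i ≥ j} (i choose j) a_i`, since
negative powers of `Λ` have only negative powers of `Δ` in their expansion. -/
def truncDelta (A : ShiftOp) : ShiftOp := fun k n =>
  ∑ᶠ j : ℕ+, (∑ᶠ i : ℕ, ((i.choose j : ℕ) : TimeField) * A (i : ℤ) n) * (delta ^ (j : ℕ)) k n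

/-- `A_{Δ^*, ≥ 1}` for `A` of order bounded below: the same with `Λ^{-i} = (1 + Δ^*)^i`. -/
def truncDeltaStar (A : ShiftOp) : ShiftOp := fun k n =>
  ∑ᶠ j : ℕ+, (∑ᶠ i : ℕ, ((i.choose j : ℕ) : TimeField) * A (-(i : ℤ)) n) *
    (deltaStar ^ (j : ℕ)) k n

/-- `∑_{l ∈ ℤ} f Λ^l g`. -/
def bilateral (f g : ℤ → TimeField) : ShiftOp := fun l n => f n * g (n + l)

/-- `T` is the inverse of `S` among the operators of order bounded above. -/
def IsInverseDown (S T : ShiftOp) : Prop := (∃ d, OrderLE T d) ∧ S * T = 1 ∧ T * S = 1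

/-- `T` is the inverse of `S` among the operators of order bounded below. -/
def IsInverseUp (S T : ShiftOp) : Prop := (∃ d, OrderGE T d) ∧ S * T = 1 ∧ T * S = 1

end ShiftOp

/-! ## Wave operators -/

/-- `S_1 = ∑_{k ≥ 0} ψ_{1,k}(n) Λ^{-k}`, where
`τ_{0,n}(t - [z⁻¹]_1) / τ_{1,n}(t) = ∑_{k ≥ 0} ψ_{1,k}(n) z^{-k}`. -/
def waveOne (τ₀ τ₁ : ℤ → TimeField) : ShiftOp := fun k n =>
  if k ≤ 0 then PowerSeries.coeff (-k).toNat (shiftTime 0 (-1) (τ₀ n)) / τ₁ n else 0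

/-- `S_2 = ∑_{k ≥ 0} ψ_{2,k}(n) Λ^k`, where
`τ_{0,n+1}(t - [z]_2) / τ_{1,n}(t) = ∑_{k ≥ 0} ψ_{2,k}(n) z^k`. -/
def waveTwo (τ₀ τ₁ : ℤ → TimeField) : ShiftOp := fun k n =>
  if 0 ≤ k then PowerSeries.coeff k.toNat (shiftTime 1 (-1) (τ₀ (n + 1))) / τ₁ n else 0

/-- `B_p^{(1)} = (L_1^p)_{Δ, ≥ 1}` (for `a = 0`) and `B_p^{(2)} = (L_2^p)_{Δ^*, ≥ 1}`
(for `a = 1`). -/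
def flow (L₁ L₂ : ShiftOp) (a : Fin 2) (p : ℕ+) : ShiftOp :=
  if a = 0 then ShiftOp.truncDelta (L₁ ^ (p : ℕ)) else ShiftOp.truncDeltaStar (L₂ ^ (p : ℕ))

/-- `q` is an mToda eigenfunction: `∂q/∂t^{(a)}_p = B_p^{(a)}(q)`. -/
def IsEigenfunction (L₁ L₂ : ShiftOp) (q : ℤ → TimeField) : Prop :=
  ∀ (a : Fin 2) (p : ℕ+) (n : ℤ), timeDeriv (a, p) (q n) = (flow L₁ L₂ a p).act q n

/-- `r` is an mToda adjoint eigenfunction: `∂r/∂t^{(a)}_p = -(Δ⁻¹ B_p^{(a)*} Δ)(r)`, for either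
expansion of `Δ⁻¹`. -/
def IsAdjointEigenfunction (L₁ L₂ : ShiftOp) (r : ℤ → TimeField) : Prop :=
  ∀ (a : Fin 2) (p : ℕ+) (n : ℤ),
    timeDeriv (a, p) (r n) =
      -(ShiftOp.invDeltaUp * (flow L₁ L₂ a p).adj * ShiftOp.delta).act r n ∧
    timeDeriv (a, p) (r n) =
      -(ShiftOp.invDeltaDown * (flow L₁ L₂ a p).adj * ShiftOp.delta).act r n

/-- The Lax formulation of the generalized bigraded mToda hierarchy. -/
structure IsGBMTLax (m M N : ℕ) (L₁ L₂ : ShiftOp) (q r : Fin m → ℤ → TimeField) : Prop where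
  constraint : L₁ ^ M * ShiftOp.invDeltaDown = L₂ ^ N * ShiftOp.invDeltaUp +
    ∑ i, ShiftOp.bilateral (q i) (fun n => r i (n + 1))
  lax : ∀ (a : Fin 2) (p : ℕ+),
    ShiftOp.deriv (a, p) L₁ = ShiftOp.comm (flow L₁ L₂ a p) L₁ ∧
    ShiftOp.deriv (a, p) L₂ = ShiftOp.comm (flow L₁ L₂ a p) L₂
  eigen : ∀ i, IsEigenfunction L₁ L₂ (q i)
  adjEigen : ∀ i, IsAdjointEigenfunction L₁ L₂ (r i)

end GBMT

end

noncomputable section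

namespace GBMT

namespace ShiftOp

/-! Only the coefficients of s^0 and of the linear monomials in s are needed. Let X_a carry the
coefficients of f(t - [w]_a) to the left of the powers of Λ (`opLeft`), and Y_a those of g(t +
[w]_a) to their right (`opRight`). With n' = n + k, the contour integrals at s = 0 are the
Λ^k-coefficients of X_0 Λ^M Y_0 and X_1 Λ^{-N} Y_1. In the coefficient of s_i, either Y_a is
differentiated or, if the time i is of kind a, a factor -Λ^{±p} appears between X_a and Y_a.

Put S_a = τ₁⁻¹ X_a(τ₀) and D_a = Y_a(τ₁) τ₀⁻¹. At order zero, the equation for (τ₀, τ₁) says S_0 D_0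
+ S_1 D_1 = ∑_l Λ^l over all integers l. The first product has powers ≤ 0 and the second has powers
≥ 1, so each S_a D_a is one half H_a of the sum (`dress_mul_dress`). As H_a is invertible, so is
S_a, with S_a⁻¹ = D_a H_a⁻¹.

Let G_a = ∂S_a S_a⁻¹, plus L_a^p if the time is of kind a (L_0 and L_1 being the Lax operators L_1
and L_2 of the theorem). At first order the same equation says G_0 H_0 + G_1 H_1 = 0. Since H_1⁻¹ =
-H_0⁻¹, this gives G_0 = G_1: one operator G, bounded above and below, hence finite, whose
coefficients sum to zero. Since ∂S_a S_a⁻¹ has no terms in the leading direction of a, G agrees with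
L^p on the positive side and vanishes on the negative side. These properties characterize the
truncation, so G is the flow operator (`flow_eq`). The Lax equations follow because L^p commutes
with L.

The equations for ρ and σ replace D_a or S_a by R_a with S_a R_a = q H_a or R_a D_a = H_a r. Their
first-order terms are the equations for q (`isEigenfunction`) and r (`timeDeriv_adjoint`). The
constraint is the s^0 term of the (M, N)-equation, multiplied on the right by Λ⁻¹
(`constraint_of_bilinear`). -/

@[ext] theorem ext {A B : ShiftOp} (h : ∀ k n, A k n = B k n) : A = B :=
  funext fun k => funext fun n => h k n

@[simp] theorem zero_apply (k n : ℤ) : (0 : ShiftOp) k n = 0 := rfl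

@[simp] theorem add_apply (A B : ShiftOp) (k n : ℤ) : (A + B) k n = A k n + B k n := rfl

@[simp] theorem sub_apply (A B : ShiftOp) (k n : ℤ) : (A - B) k n = A k n - B k n := rfl

@[simp] theorem neg_apply (A : ShiftOp) (k n : ℤ) : (-A) k n = -A k n := rfl

theorem sum_apply {ι : Type*} (s : Finset ι) (A : ι → ShiftOp) (k n : ℤ) :
    (∑ i ∈ s, A i) k n = ∑ i ∈ s, A i k n :=
  map_sum (⟨⟨fun A : ShiftOp => A k n, rfl⟩, fun _ _ => rfl⟩ : ShiftOp →+ TimeField) A s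

theorem mul_apply (A B : ShiftOp) (k n : ℤ) :
    (A * B) k n = ∑ᶠ j : ℤ, A j n * B (k - j) (n + j) := rfl

theorem shift_apply (j k n : ℤ) : shift j k n = if k = j then 1 else 0 := rfl

theorem one_apply (k n : ℤ) : (1 : ShiftOp) k n = if k = 0 then 1 else 0 := rfl

/-- Multiplication by a function of `n`. -/
def fn (f : ℤ → TimeField) : ShiftOp := fun k n => if k = 0 then f n else 0

theorem fn_apply (f : ℤ → TimeField) (k n : ℤ) : fn f k n = if k = 0 then f n else 0 := rfl

@[simp] theorem mul_shift_apply (A : ShiftOp) (m k n : ℤ) : (A * shift m) k n = A (k - m) n := by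
  rw [mul_apply, finsum_eq_single _ (k - m)]
  · simp [shift_apply]
  · intro j hj
    rw [shift_apply, if_neg (by omega), mul_zero]

@[simp] theorem shift_mul_apply (A : ShiftOp) (m k n : ℤ) :
    (shift m * A) k n = A (k - m) (n + m) := by
  rw [mul_apply, finsum_eq_single _ m]
  · simp [shift_apply]
  · intro j hj
    rw [shift_apply, if_neg hj, zero_mul]

@[simp] theorem mul_fn_apply (A : ShiftOp) (f : ℤ → TimeField) (k n : ℤ) :
    (A * fn f) k n = A k n * f (n + k) := by
  rw [mul_apply, finsum_eq_single _ k]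
  · simp [fn_apply]
  · intro j hj
    rw [fn_apply, if_neg (by omega), mul_zero]

@[simp] theorem fn_mul_apply (A : ShiftOp) (f : ℤ → TimeField) (k n : ℤ) :
    (fn f * A) k n = f n * A k n := by
  rw [mul_apply, finsum_eq_single _ 0]
  · simp [fn_apply]
  · intro j hj
    rw [fn_apply, if_neg hj, zero_mul]

protected theorem mul_one (A : ShiftOp) : A * 1 = A := by
  ext k n
  exact (mul_shift_apply A 0 k n).trans (by rw [sub_zero])

protected theorem one_mul (A : ShiftOp) : 1 * A = A := by
  ext k n
  exact (shift_mul_apply A 0 k n).trans (by rw [sub_zero, add_zero])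

/-! ## Operators of bounded order -/

/-- The sign of the direction in which the operators attached to the times `t^{(a)}` are
bounded. -/
def sgn (a : Fin 2) : ℤ := if a = 0 then 1 else -1

@[simp] theorem sgn_zero : sgn 0 = 1 := rfl

@[simp] theorem sgn_one : sgn 1 = -1 := rfl

/-- There are no terms in `Λ^k` with `d < sgn a * k`. -/
def Ord (a : Fin 2) (d : ℤ) (A : ShiftOp) : Prop := ∀ k n : ℤ, d < sgn a * k → A k n = 0

theorem Ord.mono {a : Fin 2} {d e : ℤ} {A : ShiftOp} (h : Ord a d A) (hde : d ≤ e) : Ord a e A :=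
  fun k n hk => h k n (hde.trans_lt hk)

theorem Ord.le {a : Fin 2} {d : ℤ} {A : ShiftOp} (h : Ord a d A) {k n : ℤ} (hA : A k n ≠ 0) :
    sgn a * k ≤ d :=
  not_lt.1 fun hk => hA (h k n hk)

/-- The window [-R, R] may be taken as large as desired, so that several products can be compared
over one finite index set. -/
theorem Ord.mul_eq_sum {a : Fin 2} {d e : ℤ} {A B : ShiftOp} (hA : Ord a d A) (hB : Ord a e B)
    (k n : ℤ) {R : ℤ} (hd : |d| ≤ R) (he : |e| + |k| ≤ R) :
    (A * B) k n = ∑ j ∈ Finset.Icc (-R) R, A j n * B (k - j) (n + j) := by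
  rw [mul_apply]
  refine finsum_eq_sum_of_support_subset _ fun j hj => ?_
  have h1 := hA.le (left_ne_zero_of_mul hj)
  have h2 := hB.le (right_ne_zero_of_mul hj)
  have h3 := le_abs_self d
  have h4 := le_abs_self e
  have h5 := le_abs_self k
  have h6 := neg_abs_le k
  rw [Finset.coe_Icc, Set.mem_Icc]
  revert h1 h2
  fin_cases a <;> simp <;> intros <;> constructor <;> omega

theorem Ord.mul {a : Fin 2} {d e : ℤ} {A B : ShiftOp} (hA : Ord a d A) (hB : Ord a e B) :
    Ord a (d + e) (A * B) := by
  intro k n hk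
  rw [mul_apply]
  refine finsum_eq_zero_of_forall_eq_zero fun j => ?_
  by_contra hj
  have h1 := hA.le (left_ne_zero_of_mul hj)
  have h2 := hB.le (right_ne_zero_of_mul hj)
  rw [mul_sub] at h2
  omega

theorem Ord.mul_top {a : Fin 2} {d e : ℤ} {A B : ShiftOp} (hA : Ord a d A) (hB : Ord a e B)
    (n : ℤ) : (A * B) (sgn a * (d + e)) n = A (sgn a * d) n * B (sgn a * e) (n + sgn a * d) := by
  rw [mul_apply, finsum_eq_single _ (sgn a * d)]
  · rw [mul_add, add_sub_cancel_left]
  · intro j hj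
    by_contra h
    have h1 := hA.le (left_ne_zero_of_mul h)
    have h2 := hB.le (right_ne_zero_of_mul h)
    apply hj
    revert h1 h2
    fin_cases a <;> simp <;> intros <;> omega

theorem Ord.add {a : Fin 2} {d : ℤ} {A B : ShiftOp} (hA : Ord a d A) (hB : Ord a d B) :
    Ord a d (A + B) := fun k n hk => by rw [add_apply, hA k n hk, hB k n hk, add_zero]

theorem Ord.neg {a : Fin 2} {d : ℤ} {A : ShiftOp} (hA : Ord a d A) :
    Ord a d (-A) := fun k n hk => by rw [neg_apply, hA k n hk, neg_zero]

theorem Ord.deriv {a : Fin 2} {d : ℤ} {A : ShiftOp} (hA : Ord a d A) (i : Time) :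
    Ord a d (A.deriv i) := fun k n hk => by
  change timeDeriv i (A k n) = 0
  rw [hA k n hk, map_zero]

theorem ord_shift (a : Fin 2) (m : ℤ) : Ord a (sgn a * m) (shift m) := fun k n hk => by
  rw [shift_apply, if_neg]
  rintro rfl
  exact lt_irrefl _ hk

theorem ord_fn (a : Fin 2) (f : ℤ → TimeField) : Ord a 0 (fn f) := fun k n hk => by
  rw [fn_apply, if_neg]
  rintro rfl
  simp at hk

/-- The operators that are bounded above (`a = 0`) or below (`a = 1`). -/
def bounded (a : Fin 2) : AddSubgroup ShiftOp where
  carrier := {A | ∃ d, Ord a d A}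
  add_mem' := by
    rintro A B ⟨d, hA⟩ ⟨e, hB⟩
    exact ⟨max d e, (hA.mono (le_max_left _ _)).add (hB.mono (le_max_right _ _))⟩
  zero_mem' := ⟨0, fun _ _ _ => rfl⟩
  neg_mem' := by
    rintro A ⟨d, hA⟩
    exact ⟨d, hA.neg⟩

/-! ### The ring of operators bounded on one side -/

variable {a : Fin 2}

instance : Mul (bounded a) :=
  ⟨fun A B => ⟨A.1 * B.1, by
    obtain ⟨d, hA⟩ := A.2
    obtain ⟨e, hB⟩ := B.2
    exact ⟨d + e, hA.mul hB⟩⟩⟩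

instance : One (bounded a) := ⟨⟨1, _, ord_shift a 0⟩⟩

@[simp] theorem coe_mul (A B : bounded a) : ((A * B : bounded a) : ShiftOp) = A.1 * B.1 := rfl

@[simp] theorem coe_one : ((1 : bounded a) : ShiftOp) = 1 := rfl

theorem bounded_mul_eq_sum (A B : bounded a) (k n : ℤ) :
    ∃ R₀, ∀ R ≥ R₀, (A.1 * B.1) k n = ∑ j ∈ Finset.Icc (-R) R, A.1 j n * B.1 (k - j) (n + j) := by
  obtain ⟨d, hA⟩ := A.2
  obtain ⟨e, hB⟩ := B.2
  refine ⟨max |d| (|e| + |k|), fun R hR => ?_⟩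
  exact hA.mul_eq_sum hB k n ((le_max_left _ _).trans hR) ((le_max_right _ _).trans hR)

theorem bounded_mul_add (A B C : bounded a) : A.1 * (B.1 + C.1) = A.1 * B.1 + A.1 * C.1 := by
  ext k n
  obtain ⟨R₁, h₁⟩ := bounded_mul_eq_sum A B k n
  obtain ⟨R₂, h₂⟩ := bounded_mul_eq_sum A C k n
  obtain ⟨R₃, h₃⟩ := bounded_mul_eq_sum A (B + C) k n
  set R := max R₁ (max R₂ R₃)
  rw [add_apply, h₁ R (by simp [R]), h₂ R (by simp [R]), ← Finset.sum_add_distrib]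
  refine (h₃ R (by simp [R])).trans (Finset.sum_congr rfl fun j _ => ?_)
  exact mul_add _ _ _

theorem bounded_add_mul (A B C : bounded a) : (A.1 + B.1) * C.1 = A.1 * C.1 + B.1 * C.1 := by
  ext k n
  obtain ⟨R₁, h₁⟩ := bounded_mul_eq_sum A C k n
  obtain ⟨R₂, h₂⟩ := bounded_mul_eq_sum B C k n
  obtain ⟨R₃, h₃⟩ := bounded_mul_eq_sum (A + B) C k n
  set R := max R₁ (max R₂ R₃)
  rw [add_apply, h₁ R (by simp [R]), h₂ R (by simp [R]), ← Finset.sum_add_distrib]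
  refine (h₃ R (by simp [R])).trans (Finset.sum_congr rfl fun j _ => ?_)
  exact add_mul _ _ _

theorem deriv_mul (i : Time) (A B : bounded a) :
    (A.1 * B.1).deriv i = A.1.deriv i * B.1 + A.1 * B.1.deriv i := by
  ext k n
  obtain ⟨d, hA⟩ := A.2
  obtain ⟨e, hB⟩ := B.2
  have hd : |d| ≤ max |d| (|e| + |k|) := le_max_left _ _
  have he : |e| + |k| ≤ max |d| (|e| + |k|) := le_max_right _ _
  rw [add_apply, (hA.deriv i).mul_eq_sum hB k n hd he, hA.mul_eq_sum (hB.deriv i) k n hd he]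
  change timeDeriv i ((A.1 * B.1) k n) = _
  rw [hA.mul_eq_sum hB k n hd he, map_sum, ← Finset.sum_add_distrib]
  refine Finset.sum_congr rfl fun j _ => ?_
  rw [Derivation.leibniz, smul_eq_mul, smul_eq_mul, add_comm, mul_comm (B.1 _ _)]
  rfl

theorem Ord.mul_assoc {d₁ d₂ d₃ : ℤ} {A B C : ShiftOp} (hA : Ord a d₁ A) (hB : Ord a d₂ B)
    (hC : Ord a d₃ C) : A * B * C = A * (B * C) := by
  ext k n
  set R := |d₁| + |d₂| + |d₃| + |k| with hR
  have e1 := abs_nonneg d₁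
  have e2 := abs_nonneg d₂
  have e3 := abs_nonneg d₃
  have e4 := abs_nonneg k
  have f12 := abs_add_le d₁ d₂
  have f23 := abs_add_le d₂ d₃
  rw [(hA.mul hB).mul_eq_sum hC k n (R := R) (by omega) (by omega),
    hA.mul_eq_sum (hB.mul hC) k n (R := R) (by omega) (by omega)]
  -- For |l| ≤ R the coefficient of Λ^l in A * B can require indices up to |d₂| + |l|, whence the
  -- window 2R. The extra terms vanish at the end because all three factors are bounded on the same
  -- side.
  have hl : ∀ l ∈ Finset.Icc (-R) R, (A * B) l n * C (k - l) (n + l) =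
      ∑ j ∈ Finset.Icc (-(2 * R)) (2 * R),
        A j n * B (l - j) (n + j) * C (k - l) (n + l) := by
    intro l hl
    have : |l| ≤ R := abs_le.2 (Finset.mem_Icc.1 hl)
    rw [hA.mul_eq_sum hB l n (R := 2 * R) (by omega) (by omega), Finset.sum_mul]
  have hj : ∀ j ∈ Finset.Icc (-R) R, A j n * (B * C) (k - j) (n + j) =
      ∑ l ∈ Finset.Icc (-R) R, A j n * B (l - j) (n + j) * C (k - l) (n + l) := by
    intro j _
    by_cases hAj : A j n = 0
    · simp [hAj]
    rw [mul_apply, ← finsum_comp_equiv (Equiv.subRight j)]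
    rw [finsum_eq_sum_of_support_subset (s := Finset.Icc (-R) R), Finset.mul_sum]
    · refine Finset.sum_congr rfl fun l _ => ?_
      simp only [Equiv.subRight_apply]
      rw [show k - j - (l - j) = k - l by ring, show n + j + (l - j) = n + l by ring,
        _root_.mul_assoc]
    · intro l hl
      have h1 := hA.le hAj
      have h2 := hB.le (left_ne_zero_of_mul hl)
      have h3 := hC.le (right_ne_zero_of_mul hl)
      have g1 := le_abs_self d₁
      have g2 := le_abs_self d₂
      have g3 := le_abs_self d₃
      have g4 := le_abs_self k
      have g5 := neg_abs_le k
      rw [Finset.coe_Icc, Set.mem_Icc]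
      revert h1 h2 h3
      fin_cases a <;> simp <;> intros <;> constructor <;> omega
  rw [Finset.sum_congr rfl hl, Finset.sum_congr rfl hj, Finset.sum_comm]
  symm
  refine Finset.sum_subset (Finset.Icc_subset_Icc (by omega) (by omega)) fun j _ hj => ?_
  refine Finset.sum_eq_zero fun l hl => ?_
  by_contra h
  have h1 := hA.le (left_ne_zero_of_mul (left_ne_zero_of_mul h))
  have h2 := hB.le (right_ne_zero_of_mul (left_ne_zero_of_mul h))
  have h3 := hC.le (right_ne_zero_of_mul h)
  have g1 := le_abs_self d₁
  have g2 := le_abs_self d₂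
  have g3 := le_abs_self d₃
  have g4 := le_abs_self k
  have g5 := neg_abs_le k
  apply hj
  rw [Finset.mem_Icc]
  revert h1 h2 h3
  fin_cases a <;> simp <;> intros <;> constructor <;> omega

instance : Ring (bounded a) :=
  { (inferInstance : AddCommGroup (bounded a)) with
    mul := (· * ·)
    one := 1
    left_distrib := fun A B C => Subtype.ext (bounded_mul_add A B C)
    right_distrib := fun A B C => Subtype.ext (bounded_add_mul A B C)
    zero_mul := fun A => Subtype.ext <| ext fun k n =>
      finsum_eq_zero_of_forall_eq_zero fun j => zero_mul _
    mul_zero := fun A => Subtype.ext <| ext fun k n =>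
      finsum_eq_zero_of_forall_eq_zero fun j => mul_zero _
    mul_assoc := fun A B C => by
      obtain ⟨_, hA⟩ := A.2
      obtain ⟨_, hB⟩ := B.2
      obtain ⟨_, hC⟩ := C.2
      exact Subtype.ext (hA.mul_assoc hB hC)
    one_mul := fun A => Subtype.ext (ShiftOp.one_mul A.1)
    mul_one := fun A => Subtype.ext (ShiftOp.mul_one A.1) }

@[simp] theorem coe_add (A B : bounded a) : ((A + B : bounded a) : ShiftOp) = A.1 + B.1 := rfl

@[simp] theorem coe_sub (A B : bounded a) : ((A - B : bounded a) : ShiftOp) = A.1 - B.1 := rfl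

@[simp] theorem coe_neg (A : bounded a) : ((-A : bounded a) : ShiftOp) = -A.1 := rfl

@[simp] theorem coe_zero : ((0 : bounded a) : ShiftOp) = 0 := rfl

@[simp] theorem coe_pow (A : bounded a) (p : ℕ) : ((A ^ p : bounded a) : ShiftOp) = A.1 ^ p := by
  induction p with
  | zero => rw [pow_zero]; rfl
  | succ p ih => rw [pow_succ, coe_mul, ih]; rfl

/-- If `S` and `T` have order at most zero and `S * T = 1`, then `T * S = 1`. -/
theorem mul_eq_one_comm_of_ord {S T : bounded a} (hS : Ord a 0 S.1) (hT : Ord a 0 T.1)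
    (h : S * T = 1) : T * S = 1 := by
  -- The coefficients of Λ^0 in S * T and T * S are both the product of the two leading
  -- coefficients, which commute. Hence 1 - T * S is an idempotent of negative order; being equal to
  -- all its powers, it has order below every bound and vanishes.
  have hlead : ∀ n, (T.1 * S.1) 0 n = 1 := fun n => by
    have h1 := hS.mul_top hT n
    have h2 := hT.mul_top hS n
    simp only [add_zero, mul_zero] at h1 h2
    rw [h2, mul_comm, ← h1, ← coe_mul, h]
    rfl
  set e : bounded a := 1 - T * S with he
  have hidem : e * e = e := by
    have : T * S * (T * S) = T * S := by
      rw [mul_assoc, ← mul_assoc S, h, one_mul]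
    rw [he, sub_mul, mul_sub, mul_sub, this]
    simp
  have hord : Ord a (-1) e.1 := fun k n hk => by
    change (1 : ShiftOp) k n - (T.1 * S.1) k n = 0
    by_cases hk0 : k = 0
    · subst hk0
      rw [hlead, one_apply, if_pos rfl, sub_self]
    · have hk' : 0 < sgn a * k := by
        have : sgn a * k ≠ 0 := mul_ne_zero (by fin_cases a <;> simp) hk0
        omega
      rw [(hT.mul hS) k n hk', one_apply, if_neg hk0, sub_self]
  have hpow : ∀ p : ℕ, Ord a (-1 - p) e.1 := by
    intro p
    induction p with
    | zero => simpa using hord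
    | succ p ih =>
      rw [← hidem, coe_mul]
      exact (hord.mul ih).mono (by push_cast; omega)
  have he0 : e = 0 := Subtype.ext <| ext fun k n =>
    hpow (sgn a * k).natAbs k n (by omega)
  rw [he, sub_eq_zero] at he0
  exact he0.symm

/-- Differentiation of the coefficients of a bounded operator. -/
def bderiv (i : Time) (A : bounded a) : bounded a :=
  ⟨A.1.deriv i, A.2.imp fun _ h => h.deriv i⟩

theorem bderiv_mul (i : Time) (A B : bounded a) :
    bderiv i (A * B) = bderiv i A * B + A * bderiv i B := Subtype.ext (deriv_mul i A B)

theorem deriv_shift (i : Time) (m : ℤ) : (shift m).deriv i = 0 := by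
  ext k n
  change timeDeriv i (if k = m then 1 else 0) = 0
  split_ifs <;> simp

/-- `Λ^m` as a bounded operator. -/
def lam (a : Fin 2) (m : ℤ) : bounded a := ⟨shift m, _, ord_shift a m⟩

/-- Multiplication by a function of `n` as a bounded operator. -/
def bfn (a : Fin 2) (f : ℤ → TimeField) : bounded a := ⟨fn f, _, ord_fn a f⟩

@[simp] theorem coe_lam (m : ℤ) : (lam a m : ShiftOp) = shift m := rfl

@[simp] theorem coe_bfn (f : ℤ → TimeField) : (bfn a f : ShiftOp) = fn f := rfl

theorem bderiv_lam (i : Time) (m : ℤ) : bderiv i (lam a m) = 0 := Subtype.ext (deriv_shift i m)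

theorem bderiv_one (i : Time) : bderiv i (1 : bounded a) = 0 := bderiv_lam i 0

theorem lam_mul_lam (m k : ℤ) : lam a m * lam a k = lam a (m + k) := by
  apply Subtype.ext
  ext j n
  simp only [coe_mul, coe_lam, mul_shift_apply, shift_apply]
  congr 1
  exact propext ⟨by omega, by omega⟩

theorem lam_zero : lam a 0 = 1 := rfl

theorem lam_pow (m : ℤ) (p : ℕ) : lam a m ^ p = lam a (m * p) := by
  induction p with
  | zero => simp [lam_zero]
  | succ p ih => rw [pow_succ, ih, lam_mul_lam]; congr 1; push_cast; ring

/-! ### The two halves of the bilateral sum of powers of Λ -/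

/-- The half of `∑_{l ∈ ℤ} Λ^l` with `l ≤ 0` (for `a = 0`) or with `l ≥ 1` (for `a = 1`). -/
def half (a : Fin 2) : ShiftOp := fun k _ => if sgn a * k + a.val ≤ 0 then 1 else 0

theorem half_zero_apply (k n : ℤ) : half 0 k n = if k ≤ 0 then 1 else 0 := by
  simp [half]

theorem half_one_apply (k n : ℤ) : half 1 k n = if 1 ≤ k then 1 else 0 := by
  simp only [half, sgn_one, Fin.val_one, Nat.cast_one]
  congr 1
  exact propext ⟨by omega, by omega⟩

theorem ord_half (a : Fin 2) : Ord a 0 (half a) := fun k n hk =>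
  if_neg (by omega)

/-- `half` as a bounded operator. -/
def bhalf (a : Fin 2) : bounded a := ⟨half a, _, ord_half a⟩

@[simp] theorem coe_bhalf : (bhalf a : ShiftOp) = half a := rfl

/-- The inverse of `half`. -/
def bhalfInv (a : Fin 2) : bounded a := if a = 0 then 1 - lam a (-1) else lam a (-1) - 1

theorem ord_bhalfInv_zero : Ord 0 0 (bhalfInv 0).1 := by
  intro k n hk
  simp at hk
  simp only [bhalfInv, if_true, coe_sub, coe_one, coe_lam, sub_apply, one_apply, shift_apply]
  rw [if_neg (by omega), if_neg (by omega), sub_zero]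

theorem ord_bhalfInv_one : Ord 1 1 (bhalfInv 1).1 := by
  intro k n hk
  simp at hk
  simp only [bhalfInv, one_ne_zero, if_false, coe_sub, coe_one, coe_lam, sub_apply, one_apply,
    shift_apply]
  rw [if_neg (by omega), if_neg (by omega), sub_zero]

/-- The opposite signs express that 1 - Λ⁻¹ kills the bilateral sum of the Λ^l. They turn the
first-order equation into an equality of generators. -/
theorem coe_bhalfInv_one : (bhalfInv 1).1 = -(bhalfInv 0).1 := by
  simp only [bhalfInv, one_ne_zero, if_false, if_true, coe_sub, coe_one, coe_lam, neg_sub]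

theorem bhalf_mul_bhalfInv (a : Fin 2) : bhalf a * bhalfInv a = 1 := by
  apply Subtype.ext
  ext k n
  match a with
  | 0 =>
    rw [bhalfInv, if_pos rfl, mul_sub, mul_one]
    simp only [coe_sub, coe_mul, coe_lam, coe_bhalf, coe_one, sub_apply, mul_shift_apply,
      half_zero_apply, one_apply]
    split_ifs <;> first | omega | simp
  | 1 =>
    rw [bhalfInv, if_neg (by simp), mul_sub, mul_one]
    simp only [coe_sub, coe_mul, coe_lam, coe_bhalf, coe_one, sub_apply, mul_shift_apply,
      half_one_apply, one_apply]
    split_ifs <;> first | omega | simp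

theorem bhalfInv_mul_bhalf (a : Fin 2) : bhalfInv a * bhalf a = 1 := by
  apply Subtype.ext
  ext k n
  match a with
  | 0 =>
    rw [bhalfInv, if_pos rfl, sub_mul, one_mul]
    simp only [coe_sub, coe_mul, coe_lam, coe_bhalf, coe_one, sub_apply, shift_mul_apply,
      half_zero_apply, one_apply]
    split_ifs <;> first | omega | simp
  | 1 =>
    rw [bhalfInv, if_neg (by simp), sub_mul, one_mul]
    simp only [coe_sub, coe_mul, coe_lam, coe_bhalf, coe_one, sub_apply, shift_mul_apply,
      half_one_apply, one_apply]
    split_ifs <;> first | omega | simp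

theorem bderiv_bhalf (i : Time) : bderiv i (bhalf a) = 0 := by
  apply Subtype.ext
  ext k n
  have h : timeDeriv i (half a k n) = 0 := by
    unfold half
    split_ifs
    · exact Derivation.map_one_eq_zero _
    · exact map_zero _
  exact h

/-- An operator of the form `∑_l q Λ^l r` is split into its halves. -/
theorem eq_half_of_add_eq {A₀ A₁ : ShiftOp} (h₀ : Ord 0 0 A₀) (h₁ : Ord 1 (-1) A₁)
    {q r : ℤ → TimeField} (h : ∀ k n, A₀ k n + A₁ k n = q n * r (n + k)) :
    A₀ = fn q * half 0 * fn r ∧ A₁ = fn q * half 1 * fn r := by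
  have h₀' : ∀ k n, 0 < k → A₀ k n = 0 := fun k n hk => h₀ k n (by simpa using hk)
  have h₁' : ∀ k n, k ≤ 0 → A₁ k n = 0 := fun k n hk => h₁ k n (by rw [sgn_one]; omega)
  constructor
  · ext k n
    rw [mul_fn_apply, fn_mul_apply, half_zero_apply]
    split_ifs with hk
    · rw [mul_one, ← h, h₁' k n hk, add_zero]
    · rw [h₀' k n (by omega)]; simp
  · ext k n
    rw [mul_fn_apply, fn_mul_apply, half_one_apply]
    split_ifs with hk
    · rw [mul_one, ← h, h₀' k n (by omega), zero_add]
    · rw [h₁' k n (by omega)]; simp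

/-- A finite operator times the bilateral sum of the Λ^l has every coefficient equal to the value of
that operator on the constant 1. -/
theorem mul_half_add_apply {G : ShiftOp} {d e : ℤ} (h₀ : Ord 0 d G) (h₁ : Ord 1 e G) (k n : ℤ) :
    (G * half 0) k n + (G * half 1) k n = ∑ᶠ j, G j n := by
  have hfin : (Function.support fun j => G j n).Finite := by
    refine (Set.finite_Icc (-e) d).subset fun j hj => ⟨?_, ?_⟩
    · have := h₁.le hj
      simp at this
      omega
    · simpa using h₀.le hj
  rw [mul_apply, mul_apply, ← finsum_add_distrib]
  · refine finsum_congr fun j => ?_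
    rw [half_zero_apply, half_one_apply]
    split_ifs <;> first | omega | simp
  · exact hfin.subset fun j hj => left_ne_zero_of_mul hj
  · exact hfin.subset fun j hj => left_ne_zero_of_mul hj

/-- The mirror image of `mul_half_add_apply`; at k = 0 the right-hand side is the adjoint of G
applied to the constant 1. -/
theorem half_mul_add_apply {G : ShiftOp} {d e : ℤ} (h₀ : Ord 0 d G) (h₁ : Ord 1 e G) (k n : ℤ) :
    (half 0 * G) k n + (half 1 * G) k n = ∑ᶠ j, G (k - j) (n + j) := by
  have hfin : (Function.support fun j => G (k - j) (n + j)).Finite := by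
    refine (Set.finite_Icc (k - d) (k + e)).subset fun j hj => ?_
    have h2 := h₁.le hj
    have h3 := h₀.le hj
    simp at h2 h3
    exact ⟨by omega, by omega⟩
  rw [mul_apply, mul_apply, ← finsum_add_distrib]
  · refine finsum_congr fun j => ?_
    rw [half_zero_apply, half_one_apply]
    split_ifs <;> first | omega | simp
  · exact hfin.subset fun j hj => right_ne_zero_of_mul hj
  · exact hfin.subset fun j hj => right_ne_zero_of_mul hj

/-! ## Truncations -/

/-- The binomial theorem for Λ^{mi} = (1 + (Λ^m - 1))^i, with a range of summation independent of i
so that sums over i and j can be exchanged. -/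
theorem sum_choose_mul_pow (m : ℤ) (i R : ℕ) (hi : i ≤ R) (k n : ℤ) :
    ∑ j ∈ Finset.range (R + 1), ((i.choose j : ℕ) : TimeField) * ((shift m - 1) ^ j) k n =
      shift (m * i) k n := by
  have h1 : lam 0 (m * i) =
      ∑ j ∈ Finset.range (R + 1), (i.choose j) • (lam 0 m - 1 : bounded 0) ^ j := by
    rw [← lam_pow]
    conv_lhs => rw [← sub_add_cancel (lam 0 m) 1]
    rw [(Commute.one_right _).add_pow]
    rw [← Finset.sum_subset (Finset.range_subset_range.2 (Nat.succ_le_succ hi))]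
    · refine Finset.sum_congr rfl fun j _ => ?_
      rw [one_pow, mul_one, nsmul_eq_mul, Nat.cast_comm]
    · intro j _ hj
      rw [Nat.choose_eq_zero_of_lt (by simpa using hj), zero_smul]
  have h2 := congrArg (fun A : bounded 0 => A.1 k n) h1
  simp only [coe_lam] at h2
  rw [h2, AddSubgroup.val_finsetSum, sum_apply]
  refine Finset.sum_congr rfl fun j _ => ?_
  rw [← nsmul_eq_mul, AddSubgroup.coe_nsmul, coe_pow]
  rfl

/-- The part of `A` with positive powers in the expansion in powers of `Λ^m - 1`, `m = sgn a`,
is the finite operator that annihilates constants and has the same coefficients as `A` in the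
direction of `m`. -/
theorem trunc_eq {A B : ShiftOp} {d : ℕ} (hA : Ord a d A) (hB : ∀ k n, sgn a * k < 0 → B k n = 0)
    (hsum : ∀ n, ∑ᶠ k, B k n = 0) (hAB : ∀ k n, 0 < sgn a * k → B k n = A k n) (k n : ℤ) :
    ∑ᶠ j : ℕ+, (∑ᶠ i : ℕ, ((i.choose j : ℕ) : TimeField) * A (sgn a * i) n) *
      ((shift (sgn a) - 1) ^ (j : ℕ)) k n = B k n := by
  have hss : sgn a * sgn a = 1 := by fin_cases a <;> rfl
  have hA' : ∀ i : ℕ, d < i → A (sgn a * i) n = 0 := fun i hi =>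
    hA _ _ (by rw [← mul_assoc, hss]; omega)
  -- `u j` is the term of degree j in the expansion of the part of A with nonnegative powers. All
  -- terms add up to that part (`h3`), and the truncation drops only `u 0`, the sum of its
  -- coefficients times the identity (`h4`).
  set u : ℕ → TimeField := fun j =>
    (∑ i ∈ Finset.range (d + 1), ((i.choose j : ℕ) : TimeField) * A (sgn a * i) n) *
      ((shift (sgn a) - 1) ^ j) k n with hu
  have h1 : ∀ j : ℕ, (∑ᶠ i : ℕ, ((i.choose j : ℕ) : TimeField) * A (sgn a * i) n) =
      ∑ i ∈ Finset.range (d + 1), ((i.choose j : ℕ) : TimeField) * A (sgn a * i) n := fun j => by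
    refine finsum_eq_sum_of_support_subset _ fun i hi => ?_
    by_contra hi'
    refine right_ne_zero_of_mul hi (hA' i ?_)
    simpa using hi'
  have hu0 : ∀ j, d < j → u j = 0 := fun j hj => by
    rw [hu]
    simp only
    rw [Finset.sum_eq_zero, zero_mul]
    intro i hi
    rw [Nat.choose_eq_zero_of_lt (by rw [Finset.mem_range] at hi; omega), Nat.cast_zero, zero_mul]
  have h2 : ∑ᶠ j : ℕ+, u j = ∑ j ∈ Finset.range d, u (j + 1) := by
    rw [← finsum_comp_equiv Equiv.pnatEquivNat.symm]
    rw [finsum_eq_sum_of_support_subset (s := Finset.range d)]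
    · rfl
    · intro j hj
      by_contra hj'
      refine hj (hu0 _ ?_)
      simp at hj'
      simp
      omega
  have h3 : ∑ j ∈ Finset.range (d + 1), u j =
      ∑ i ∈ Finset.range (d + 1), A (sgn a * i) n * shift (sgn a * i) k n := by
    simp only [hu, Finset.sum_mul]
    rw [Finset.sum_comm]
    refine Finset.sum_congr rfl fun i hi => ?_
    rw [← sum_choose_mul_pow (sgn a) i d (by rw [Finset.mem_range] at hi; omega), Finset.mul_sum]
    refine Finset.sum_congr rfl fun j _ => ?_
    ring
  have h4 : u 0 = (∑ i ∈ Finset.range (d + 1), A (sgn a * i) n) * (1 : ShiftOp) k n := by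
    simp only [hu, Nat.choose_zero_right, Nat.cast_one, one_mul]
    rfl
  have h5 : ∑ᶠ k, B k n = ∑ i ∈ Finset.range (d + 1), B (sgn a * i) n := by
    rw [finsum_eq_sum_of_support_subset
      (s := (Finset.range (d + 1)).image fun i : ℕ => sgn a * i), Finset.sum_image]
    · intro i _ j _ hij
      have := mul_left_cancel₀ (by fin_cases a <;> simp : sgn a ≠ 0) hij
      exact_mod_cast this
    · intro j hj
      have hj0 : 0 ≤ sgn a * j := not_lt.1 fun h => hj (hB j n h)
      have hjd : sgn a * j ≤ d := not_lt.1 fun h => hj (by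
        change B j n = 0
        rw [hAB j n (by omega)]
        exact hA j n h)
      rw [Finset.coe_image, Set.mem_image]
      refine ⟨(sgn a * j).toNat, ?_, ?_⟩
      · rw [Finset.coe_range, Set.mem_Iio]
        omega
      · rw [Int.toNat_of_nonneg hj0, ← mul_assoc, hss, one_mul]
  have h6 : ∀ i : ℕ, B (sgn a * (i + 1 : ℕ)) n = A (sgn a * (i + 1 : ℕ)) n := fun i =>
    hAB _ _ (by rw [← mul_assoc, hss]; push_cast; omega)
  have h7 : B 0 n + ∑ i ∈ Finset.range d, A (sgn a * (i + 1 : ℕ)) n = 0 := by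
    rw [← hsum n, h5, Finset.sum_range_succ', add_comm, Finset.sum_congr rfl fun i _ => h6 i]
    simp
  simp only [h1]
  change ∑ᶠ j : ℕ+, u j = _
  rw [h2]
  have h8 : ∑ j ∈ Finset.range d, u (j + 1) =
      (∑ i ∈ Finset.range d, A (sgn a * (i + 1 : ℕ)) n * shift (sgn a * (i + 1 : ℕ)) k n) -
        (∑ i ∈ Finset.range d, A (sgn a * (i + 1 : ℕ)) n) * (1 : ShiftOp) k n := by
    rw [Finset.sum_range_succ', Finset.sum_range_succ', h4, Finset.sum_range_succ'] at h3
    have hs : shift (sgn a * (0 : ℕ)) k n = (1 : ShiftOp) k n := by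
      rw [Nat.cast_zero, mul_zero]; rfl
    rw [hs] at h3
    linear_combination h3
  rw [h8]
  by_cases hk : 0 < sgn a * k
  · rw [hAB k n hk, one_apply, if_neg (by rintro rfl; simp at hk), mul_zero, sub_zero]
    obtain ⟨i, hi⟩ : ∃ i : ℕ, k = sgn a * (i + 1 : ℕ) :=
      ⟨(sgn a * k - 1).toNat, by
        rw [Nat.cast_add, Int.toNat_of_nonneg (by omega), Nat.cast_one, sub_add_cancel,
          ← mul_assoc, hss, one_mul]⟩
    by_cases hid : i < d
    · rw [Finset.sum_eq_single_of_mem i (by simpa using hid)]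
      · rw [← hi, shift_apply, if_pos rfl, mul_one]
      · intro j _ hj
        rw [shift_apply, if_neg, mul_zero]
        intro h
        rw [hi] at h
        have := mul_left_cancel₀ (by fin_cases a <;> simp : sgn a ≠ 0) h
        omega
    · rw [hi, hA' (i + 1) (by omega)]
      refine Finset.sum_eq_zero fun j hj => ?_
      rw [shift_apply, if_neg, mul_zero]
      intro h
      have := mul_left_cancel₀ (by fin_cases a <;> simp : sgn a ≠ 0) h
      rw [Finset.mem_range] at hj
      omega
  · have hz : ∑ i ∈ Finset.range d,
        A (sgn a * (i + 1 : ℕ)) n * shift (sgn a * (i + 1 : ℕ)) k n = 0 := by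
      refine Finset.sum_eq_zero fun j _ => ?_
      rw [shift_apply, if_neg, mul_zero]
      rintro rfl
      rw [← mul_assoc, hss] at hk
      push_cast at hk
      omega
    rw [hz]
    by_cases hk0 : k = 0
    · subst hk0
      rw [one_apply, if_pos rfl]
      linear_combination -h7
    · rw [one_apply, if_neg hk0, hB k n]
      · simp
      · have : sgn a * k ≠ 0 := mul_ne_zero (by fin_cases a <;> simp) hk0
        omega

end ShiftOp

/-! ## The bilinear equations to first order in `s` -/

theorem laurent_coeff_mul (x y : LaurentSeries TimeField) (l : ℤ) :
    (x * y).coeff l = ∑ᶠ j : ℤ, x.coeff j * y.coeff (l - j) := by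
  classical
  rw [HahnSeries.coeff_mul, finsum_eq_sum_of_support_subset
    (s := (Finset.antidiagonal x.isPWO_support y.isPWO_support l).image Prod.fst),
    Finset.sum_image]
  · refine Finset.sum_congr rfl fun p hp => ?_
    rw [Finset.mem_antidiagonal] at hp
    rw [← hp.2.2, add_sub_cancel_left]
  · intro p hp p' hp' h
    rw [Finset.mem_coe, Finset.mem_antidiagonal] at hp hp'
    have h1 := hp.2.2
    have h2 := hp'.2.2
    exact Prod.ext h (by omega)
  · intro j hj
    rw [Finset.coe_image, Set.mem_image]
    refine ⟨(j, l - j), ?_, rfl⟩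
    rw [Finset.mem_coe, Finset.mem_antidiagonal]
    exact ⟨left_ne_zero_of_mul hj, right_ne_zero_of_mul hj, add_sub_cancel _ _⟩

theorem taylor_coeff_zero (f : TimeField) : MvPowerSeries.coeff 0 (taylor f) = f := by
  change ((0 : Time →₀ ℕ).prod fun _ e => ((e.factorial : TimeField))⁻¹) * iterDeriv 0 f = f
  simp [iterDeriv]

theorem taylor_coeff_single (i : Time) (f : TimeField) :
    MvPowerSeries.coeff (Finsupp.single i 1) (taylor f) = timeDeriv i f := by
  change ((Finsupp.single i 1).prod fun _ e => ((e.factorial : TimeField))⁻¹) *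
    iterDeriv (Finsupp.single i 1) f = _
  rw [Finsupp.prod_single_index (by simp)]
  simp [iterDeriv]

theorem twoPoint_coeff_zero (f g : TimeField) :
    MvPowerSeries.coeff 0 (twoPoint f g) = f * g := by
  rw [twoPoint, MvPowerSeries.coeff_C_mul, taylor_coeff_zero]

theorem twoPoint_coeff_single (i : Time) (f g : TimeField) :
    MvPowerSeries.coeff (Finsupp.single i 1) (twoPoint f g) = f * timeDeriv i g := by
  rw [twoPoint, MvPowerSeries.coeff_C_mul, taylor_coeff_single]

/-- The Laurent series `f(t + ε [w]_a)`. -/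
def laurentShift (a : Fin 2) (ε f : TimeField) : LaurentSeries TimeField :=
  HahnSeries.ofPowerSeries ℤ TimeField (shiftTime a ε f)

/-- Differentiation of the coefficients of `f(t + ε [w]_a)`. -/
def laurentShiftDeriv (i : Time) (a : Fin 2) (ε f : TimeField) : LaurentSeries TimeField :=
  HahnSeries.ofPowerSeries ℤ TimeField
    (PowerSeries.mk fun j => timeDeriv i (PowerSeries.coeff j (shiftTime a ε f)))

theorem ofPowerSeries_coeff_neg (P : PowerSeries TimeField) {l : ℤ} (hl : l < 0) :
    (HahnSeries.ofPowerSeries ℤ TimeField P).coeff l = 0 := by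
  rw [HahnSeries.ofPowerSeries_apply]
  apply HahnSeries.embDomain_of_notMem_range
  rintro ⟨j, hj⟩
  have : (j : ℤ) = l := hj
  omega

theorem laurentShift_coeff_neg (a : Fin 2) (ε f : TimeField) {l : ℤ} (hl : l < 0) :
    (laurentShift a ε f).coeff l = 0 := ofPowerSeries_coeff_neg _ hl

theorem laurentShift_coeff (a : Fin 2) (ε f : TimeField) {l : ℤ} (hl : 0 ≤ l) :
    (laurentShift a ε f).coeff l = PowerSeries.coeff l.toNat (shiftTime a ε f) := by
  lift l to ℕ using hl
  exact HahnSeries.ofPowerSeries_apply_coeff _ _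

theorem laurentShiftDeriv_coeff (i : Time) (a : Fin 2) (ε f : TimeField) (l : ℤ) :
    (laurentShiftDeriv i a ε f).coeff l = timeDeriv i ((laurentShift a ε f).coeff l) := by
  rcases lt_or_ge l 0 with hl | hl
  · rw [laurentShift_coeff_neg _ _ _ hl, laurentShiftDeriv, ofPowerSeries_coeff_neg _ hl, map_zero]
  · rw [laurentShift_coeff _ _ _ hl]
    lift l to ℕ using hl
    rw [laurentShiftDeriv, HahnSeries.ofPowerSeries_apply_coeff, PowerSeries.coeff_mk,
      Int.toNat_natCast]

theorem factorAtT'_coeff_zero (a : Fin 2) (g : TimeField) :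
    MvPowerSeries.coeff 0 (factorAtT' a g) = laurentShift a 1 g := by
  change HahnSeries.ofPowerSeries ℤ TimeField (PowerSeries.mk fun j =>
      MvPowerSeries.coeff 0 (taylor (PowerSeries.coeff j (shiftTime a 1 g)))) = _
  simp only [taylor_coeff_zero]
  congr 1
  ext j
  exact PowerSeries.coeff_mk _ _

theorem factorAtT'_coeff_single (i : Time) (a : Fin 2) (g : TimeField) :
    MvPowerSeries.coeff (Finsupp.single i 1) (factorAtT' a g) = laurentShiftDeriv i a 1 g := by
  change HahnSeries.ofPowerSeries ℤ TimeField (PowerSeries.mk fun j =>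
      MvPowerSeries.coeff (Finsupp.single i 1)
        (taylor (PowerSeries.coeff j (shiftTime a 1 g)))) = _
  simp only [taylor_coeff_single]
  rfl

theorem expFactor_coeff_zero (a : Fin 2) : MvPowerSeries.coeff 0 (expFactor a) = 1 :=
  Finsupp.prod_zero_index (h := fun (i : Time) (e : ℕ) =>
    if i.1 = a then HahnSeries.single (-((i.2 : ℤ) * (e : ℤ)))
      ((-1 : TimeField) ^ e * ((e.factorial : TimeField))⁻¹) else 0)

theorem expFactor_coeff_single (i : Time) (a : Fin 2) :
    MvPowerSeries.coeff (Finsupp.single i 1) (expFactor a) =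
      if i.1 = a then HahnSeries.single (-(i.2 : ℤ)) (-1 : TimeField) else 0 := by
  change ((Finsupp.single i 1).prod fun (i : Time) (e : ℕ) =>
    if i.1 = a then HahnSeries.single (-((i.2 : ℤ) * (e : ℤ)))
      ((-1 : TimeField) ^ e * ((e.factorial : TimeField))⁻¹) else 0) = _
  rw [Finsupp.prod, Finsupp.support_single _ one_ne_zero, Finset.prod_singleton]
  simp

theorem contour_coeff_zero (a : Fin 2) (κ : ℤ) (f g : TimeField) :
    MvPowerSeries.coeff 0 (contour a κ f g) =
      (laurentShift a (-1) f * laurentShift a 1 g).coeff (-κ) := by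
  change (MvPowerSeries.coeff 0 (MvPowerSeries.C (HahnSeries.single κ (1 : TimeField)) *
      factorAtT a f * factorAtT' a g * expFactor a)).coeff 0 = _
  have h : MvPowerSeries.coeff 0 (factorAtT' a g * expFactor a) =
      MvPowerSeries.coeff 0 (factorAtT' a g) * MvPowerSeries.coeff 0 (expFactor a) :=
    map_mul MvPowerSeries.constantCoeff _ _
  rw [mul_assoc, mul_assoc, factorAtT, MvPowerSeries.coeff_C_mul, MvPowerSeries.coeff_C_mul,
    h, factorAtT'_coeff_zero, expFactor_coeff_zero, mul_one,
    HahnSeries.coeff_single_mul, one_mul, zero_sub]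
  rfl

/-- The product rule: f(t - [w]_a) does not involve s, the Taylor expansion of g contributes its
derivative, and the exponential contributes -w^{-p} for times of kind a. -/
theorem contour_coeff_single (i : Time) (a : Fin 2) (κ : ℤ) (f g : TimeField) :
    MvPowerSeries.coeff (Finsupp.single i 1) (contour a κ f g) =
      (laurentShift a (-1) f * laurentShiftDeriv i a 1 g).coeff (-κ) -
        if i.1 = a then (laurentShift a (-1) f * laurentShift a 1 g).coeff (i.2 - κ) else 0 := by
  classical
  change (MvPowerSeries.coeff (Finsupp.single i 1)
    (MvPowerSeries.C (HahnSeries.single κ (1 : TimeField)) *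
      factorAtT a f * factorAtT' a g * expFactor a)).coeff 0 = _
  have h : MvPowerSeries.coeff (Finsupp.single i 1) (factorAtT' a g * expFactor a) =
      laurentShiftDeriv i a 1 g + laurentShift a 1 g *
        if i.1 = a then HahnSeries.single (-(i.2 : ℤ)) (-1 : TimeField) else 0 := by
    rw [MvPowerSeries.coeff_mul, Finsupp.antidiagonal_single, Finset.sum_map,
      Finset.Nat.antidiagonal_succ]
    simp [factorAtT'_coeff_zero, factorAtT'_coeff_single, expFactor_coeff_zero,
      expFactor_coeff_single, add_comm, Function.Embedding.prodMap]
  rw [mul_assoc, mul_assoc, factorAtT, MvPowerSeries.coeff_C_mul, MvPowerSeries.coeff_C_mul,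
    h, HahnSeries.coeff_single_mul, one_mul, zero_sub, mul_add, HahnSeries.coeff_add]
  change _ = (laurentShift a (-1) f * laurentShiftDeriv i a 1 g).coeff (-κ) - _
  rw [sub_eq_add_neg]
  congr 1
  split_ifs
  · rw [← mul_assoc, mul_comm, HahnSeries.coeff_single_mul, neg_one_mul]
    congr 2
    ring
  · rw [mul_zero, mul_zero, HahnSeries.coeff_zero, neg_zero]

/-! ### The bilinear equations as identities between operators -/

namespace ShiftOp

/-- The operator with coefficients `f_n(t - [w]_a)`, `w = Λ^{-1}` or `Λ`. -/
def opLeft (a : Fin 2) (f : ℤ → TimeField) : ShiftOp := fun k n =>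
  (laurentShift a (-1) (f (n + a.val))).coeff (-(sgn a * k))

/-- The operator with coefficients `g_n(t + [w]_a)` on the right of the powers of `Λ`. -/
def opRight (a : Fin 2) (g : ℤ → TimeField) : ShiftOp := fun k n =>
  (laurentShift a 1 (g (n + k - a.val))).coeff (-(sgn a * k) - a.val)

theorem ord_opLeft (a : Fin 2) (f : ℤ → TimeField) : Ord a 0 (opLeft a f) := fun k n hk =>
  laurentShift_coeff_neg _ _ _ (by omega)

theorem ord_opRight (a : Fin 2) (g : ℤ → TimeField) : Ord a (-a.val) (opRight a g) :=
  fun k n hk => laurentShift_coeff_neg _ _ _ (by omega)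

/-- Since the coefficients of B stand to the right of the powers of Λ, in the Λ^k-coefficient they
are all evaluated at n + k, whatever the summation index. The operator product is therefore a
product of two fixed Laurent series, after reindexing by j ↦ K - sgn a * j. -/
theorem mul_shift_mul_apply (a : Fin 2) (K k n : ℤ) (x : LaurentSeries TimeField)
    (y : ℤ → LaurentSeries TimeField) (A B : ShiftOp)
    (hA : ∀ j, A j n = x.coeff (-(sgn a * j)))
    (hB : ∀ j m, B j m = (y (m + j)).coeff (-(sgn a * j) - a.val)) :
    (A * shift (sgn a * K) * B) k n = (x * y (n + k)).coeff (K - sgn a * k - a.val) := by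
  have hss : sgn a * sgn a = 1 := by fin_cases a <;> rfl
  let φ : ℤ ≃ ℤ :=
    { toFun := fun j => K - sgn a * j
      invFun := fun j => sgn a * (K - j)
      left_inv := fun j => by
        change sgn a * (K - (K - sgn a * j)) = j
        rw [sub_sub_cancel, ← mul_assoc, hss, one_mul]
      right_inv := fun j => by
        change K - sgn a * (sgn a * (K - j)) = j
        rw [← mul_assoc, hss, one_mul, sub_sub_cancel] }
  rw [mul_apply, laurent_coeff_mul]
  refine Eq.trans ?_ (finsum_comp_equiv φ)
  refine finsum_congr fun j => ?_
  rw [mul_shift_apply, hA, hB]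
  change _ = x.coeff (K - sgn a * j) * (y (n + k)).coeff (_ - (K - sgn a * j))
  congr 2
  · rw [mul_sub, ← mul_assoc, hss, one_mul]; ring
  · congr 1; ring
  · ring

theorem opLeft_mul_opRight_apply (a : Fin 2) (K : ℤ) (f g : ℤ → TimeField) (k n : ℤ) :
    (opLeft a f * shift (sgn a * K) * opRight a g) k n =
      (laurentShift a (-1) (f (n + a.val)) * laurentShift a 1 (g (n + k - a.val))).coeff
        (K - sgn a * k - a.val) :=
  mul_shift_mul_apply a K k n _ (fun m => laurentShift a 1 (g (m - a.val))) _ _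
    (fun _ => rfl) fun _ _ => rfl

theorem opLeft_mul_deriv_opRight_apply (i : Time) (a : Fin 2) (K : ℤ) (f g : ℤ → TimeField)
    (k n : ℤ) :
    (opLeft a f * shift (sgn a * K) * (opRight a g).deriv i) k n =
      (laurentShift a (-1) (f (n + a.val)) * laurentShiftDeriv i a 1 (g (n + k - a.val))).coeff
        (K - sgn a * k - a.val) :=
  mul_shift_mul_apply a K k n _ (fun m => laurentShiftDeriv i a 1 (g (m - a.val))) _ _
    (fun _ => rfl) fun _ _ => (laurentShiftDeriv_coeff _ _ _ _ _).symm

theorem bilinear_coeff_zero (M N : ℕ) (f g : ℤ → TimeField) (k n : ℤ) :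
    MvPowerSeries.coeff 0 (bilinear M N f g n (n + k)) =
      (opLeft 0 f * shift (sgn 0 * M) * opRight 0 g) k n +
        (opLeft 1 f * shift (sgn 1 * N) * opRight 1 g) k n := by
  rw [bilinear, map_add, contour_coeff_zero, contour_coeff_zero, opLeft_mul_opRight_apply,
    opLeft_mul_opRight_apply]
  simp only [sgn_zero, sgn_one, Fin.val_zero, Fin.val_one, Nat.cast_zero, Nat.cast_one, add_zero,
    sub_zero]
  congr 2 <;> ring

theorem bilinear_coeff_single (i : Time) (f g : ℤ → TimeField) (k n : ℤ) :
    MvPowerSeries.coeff (Finsupp.single i 1) (bilinear 0 0 f g n (n + k)) =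
      ((opLeft 0 f * (opRight 0 g).deriv i) k n -
        if i.1 = 0 then (opLeft 0 f * shift (sgn 0 * i.2) * opRight 0 g) k n else 0) +
      ((opLeft 1 f * (opRight 1 g).deriv i) k n -
        if i.1 = 1 then (opLeft 1 f * shift (sgn 1 * i.2) * opRight 1 g) k n else 0) := by
  have h : ∀ a, opLeft a f = opLeft a f * shift (sgn a * 0) := fun a => by
    rw [mul_zero]; exact (ShiftOp.mul_one _).symm
  conv_rhs =>
    enter [1, 1]
    rw [h 0]
  conv_rhs =>
    enter [2, 1]
    rw [h 1]
  rw [bilinear, map_add, contour_coeff_single, contour_coeff_single,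
    opLeft_mul_deriv_opRight_apply, opLeft_mul_deriv_opRight_apply, opLeft_mul_opRight_apply,
    opLeft_mul_opRight_apply]
  simp only [sgn_zero, sgn_one, Fin.val_zero, Fin.val_one, Nat.cast_zero, Nat.cast_one, add_zero,
    sub_zero]
  congr 3 <;> congr 1 <;> ring_nf

end ShiftOp

/-! ### Dressing by the tau functions -/

namespace ShiftOp

variable {a : Fin 2}

theorem neg_mul_neg' (A B : ShiftOp) : -A * -B = A * B := by
  ext k n
  exact finsum_congr fun j => neg_mul_neg _ _

theorem bfn_const_one : bfn a (fun _ => 1) = 1 := rfl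

theorem bderiv_bfn (i : Time) (f : ℤ → TimeField) :
    bderiv i (bfn a f) = bfn a fun n => timeDeriv i (f n) := by
  apply Subtype.ext
  ext k n
  change timeDeriv i (if k = 0 then f n else 0) = if k = 0 then timeDeriv i (f n) else 0
  split_ifs
  · rfl
  · exact map_zero _

/-- `α⁻¹` times the operator with coefficients `f_n(t - [w]_a)`. -/
def dressLeft (a : Fin 2) (α f : ℤ → TimeField) : bounded a :=
  bfn a (fun n => (α n)⁻¹) * ⟨opLeft a f, _, ord_opLeft a f⟩

/-- The operator with coefficients `g_n(t + [w]_a)` on the right, times `β⁻¹`. -/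
def dressRight (a : Fin 2) (β g : ℤ → TimeField) : bounded a :=
  ⟨opRight a g, _, ord_opRight a g⟩ * bfn a fun n => (β n)⁻¹

theorem ord_dressLeft (a : Fin 2) (α f : ℤ → TimeField) : Ord a 0 (dressLeft a α f).1 :=
  ((ord_fn a _).mul (ord_opLeft a f)).mono (add_zero 0).le

theorem ord_dressRight (a : Fin 2) (β g : ℤ → TimeField) :
    Ord a (-a.val) (dressRight a β g).1 :=
  ((ord_opRight a g).mul (ord_fn a _)).mono (add_zero _).le

/-- The linear terms in `s` of the bilinear equations, for dressed operators `S`, `D`. -/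
def firstOrder (i : Time) (S D : bounded a) : bounded a :=
  S * bderiv i D - if i.1 = a then S * lam a (sgn a * i.2) * D else 0

theorem dress_mul_apply (a : Fin 2) (α β f g : ℤ → TimeField) (m k n : ℤ) :
    (dressLeft a α f * lam a m * dressRight a β g).1 k n =
      (α n)⁻¹ * (opLeft a f * shift m * opRight a g) k n * (β (n + k))⁻¹ := by
  set X : bounded a := ⟨opLeft a f, _, ord_opLeft a f⟩
  set Y : bounded a := ⟨opRight a g, _, ord_opRight a g⟩
  have h : dressLeft a α f * lam a m * dressRight a β g =
      bfn a (fun n => (α n)⁻¹) * (X * lam a m * Y) * bfn a fun n => (β n)⁻¹ := by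
    simp only [dressLeft, dressRight, mul_assoc, X, Y]
  rw [h, coe_mul, coe_mul, coe_bfn, coe_bfn, mul_fn_apply, fn_mul_apply]
  rfl

theorem firstOrder_dress_apply (i : Time) (a : Fin 2) (α β f g : ℤ → TimeField) (k n : ℤ) :
    (firstOrder i (dressLeft a α f) (dressRight a β g)).1 k n =
      (α n)⁻¹ * ((opLeft a f * (opRight a g).deriv i) k n -
        if i.1 = a then (opLeft a f * shift (sgn a * i.2) * opRight a g) k n else 0) *
          (β (n + k))⁻¹ +
      (α n)⁻¹ * (opLeft a f * shift (sgn a * 0) * opRight a g) k n *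
        timeDeriv i ((β (n + k))⁻¹) := by
  set X : bounded a := ⟨opLeft a f, _, ord_opLeft a f⟩
  set Y : bounded a := ⟨opRight a g, _, ord_opRight a g⟩
  have h : dressLeft a α f * bderiv i (dressRight a β g) =
      bfn a (fun n => (α n)⁻¹) * (X * bderiv i Y) * bfn a (fun n => (β n)⁻¹) +
      bfn a (fun n => (α n)⁻¹) * (X * lam a (sgn a * 0) * Y) *
        bfn a (fun n => timeDeriv i ((β n)⁻¹)) := by
    rw [dressLeft, dressRight, bderiv_mul, bderiv_bfn, mul_add, mul_zero, lam_zero, mul_one]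
    simp only [mul_assoc, X, Y]
  have h2 : (if i.1 = a then dressLeft a α f * lam a (sgn a * i.2) * dressRight a β g
      else 0 : bounded a).1 k n = (α n)⁻¹ *
      (if i.1 = a then (opLeft a f * shift (sgn a * i.2) * opRight a g) k n else 0) *
      (β (n + k))⁻¹ := by
    split_ifs
    · exact dress_mul_apply _ _ _ _ _ _ _ _
    · simp
  rw [firstOrder, coe_sub, sub_apply, h2, h, coe_add, add_apply]
  simp only [coe_mul, coe_bfn, mul_fn_apply, fn_mul_apply]
  change (α n)⁻¹ * (opLeft a f * (opRight a g).deriv i) k n * _ +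
    (α n)⁻¹ * (opLeft a f * shift (sgn a * 0) * opRight a g) k n * _ - _ = _
  ring

section Pair

variable {f g u v α β : ℤ → TimeField}
  (h : ∀ n n' : ℤ, bilinear 0 0 f g n n' = twoPoint (u n) (v n'))
include h

theorem dress_add_apply (k n : ℤ) :
    (dressLeft 0 α f * dressRight 0 β g).1 k n + (dressLeft 1 α f * dressRight 1 β g).1 k n =
      u n / α n * (v (n + k) / β (n + k)) := by
  have h0 := dress_mul_apply 0 α β f g (sgn 0 * (0 : ℕ)) k n
  have h1 := dress_mul_apply 1 α β f g (sgn 1 * (0 : ℕ)) k n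
  have hb := bilinear_coeff_zero 0 0 f g k n
  rw [h, twoPoint_coeff_zero] at hb
  simp only [Nat.cast_zero, mul_zero, lam_zero, mul_one] at h0 h1 hb
  rw [h0, h1, ← add_mul, ← mul_add, ← hb]
  simp only [div_eq_mul_inv]
  ring

/-- The two products have disjoint ranges of powers, Λ^{≤ 0} and Λ^{≥ 1}, so their sum determines
each of them. -/
theorem dress_mul_dress : ∀ a : Fin 2, dressLeft a α f * dressRight a β g =
    bfn a (fun n => u n / α n) * bhalf a * bfn a fun n => v n / β n := by
  have h0 : Ord 0 0 (dressLeft 0 α f * dressRight 0 β g).1 := by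
    simpa using (ord_dressLeft 0 α f).mul (ord_dressRight 0 β g)
  have h1 : Ord 1 (-1) (dressLeft 1 α f * dressRight 1 β g).1 := by
    simpa using (ord_dressLeft 1 α f).mul (ord_dressRight 1 β g)
  have h2 := eq_half_of_add_eq h0 h1 (q := fun n => u n / α n) (r := fun n => v n / β n)
    (dress_add_apply h)
  intro a
  apply Subtype.ext
  match a with
  | 0 => exact h2.1
  | 1 => exact h2.2

/-- Differentiating β⁻¹ inside the right factor adds the zeroth-order equation multiplied by ∂(β⁻¹);
together with the first-order equation this is the Leibniz rule for v · β⁻¹. -/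
theorem firstOrder_add_apply (i : Time) (k n : ℤ) :
    (firstOrder i (dressLeft 0 α f) (dressRight 0 β g)).1 k n +
      (firstOrder i (dressLeft 1 α f) (dressRight 1 β g)).1 k n =
      u n / α n * timeDeriv i (v (n + k) / β (n + k)) := by
  have hb := bilinear_coeff_zero 0 0 f g k n
  have hs := bilinear_coeff_single i f g k n
  rw [h, twoPoint_coeff_zero] at hb
  rw [h, twoPoint_coeff_single] at hs
  simp only [Nat.cast_zero] at hb
  rw [firstOrder_dress_apply, firstOrder_dress_apply, div_eq_mul_inv, div_eq_mul_inv,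
    Derivation.leibniz, smul_eq_mul, smul_eq_mul]
  linear_combination (-(α n)⁻¹ * (β (n + k))⁻¹) * hs -
    (α n)⁻¹ * timeDeriv i (β (n + k))⁻¹ * hb

end Pair

/-! ## Wave operators and Sato equations -/

/-- Wave operators `S a` and their duals `D a`, subject to the Sato equations in the form of the
linear terms of the bilinear equation. -/
structure IsWave (S D : ∀ a : Fin 2, bounded a) : Prop where
  ord_left : ∀ a, Ord a 0 (S a).1
  ord_right : ∀ a, Ord a (-a.val) (D a).1
  mul_eq : ∀ a, S a * D a = bhalf a
  linear : ∀ i k n, (firstOrder i (S 0) (D 0)).1 k n + (firstOrder i (S 1) (D 1)).1 k n = 0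

/-- The inverse `D * half⁻¹` of a wave operator. -/
def waveInv (D : ∀ a : Fin 2, bounded a) (a : Fin 2) : bounded a := D a * bhalfInv a

/-- The Lax operators `S Λ^{±1} S⁻¹`. -/
def laxOp (S D : ∀ a : Fin 2, bounded a) (a : Fin 2) : bounded a :=
  S a * lam a (sgn a) * waveInv D a

/-- `∂S S⁻¹`. -/
def logDeriv (S D : ∀ a : Fin 2, bounded a) (i : Time) (a : Fin 2) : bounded a :=
  bderiv i (S a) * waveInv D a

/-- `∂S S⁻¹`, plus `L^p` for the times of the same kind. -/
def generator (S D : ∀ a : Fin 2, bounded a) (i : Time) (a : Fin 2) : bounded a :=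
  logDeriv S D i a + if i.1 = a then laxOp S D a ^ (i.2 : ℕ) else 0

/-! ### Consequences of the Sato equations -/

namespace IsWave

variable {S D : ∀ a : Fin 2, bounded a} (w : IsWave S D)
include w

theorem mul_inv (a : Fin 2) : S a * waveInv D a = 1 := by
  rw [waveInv, ← mul_assoc, w.mul_eq, bhalf_mul_bhalfInv]

theorem ord_inv (a : Fin 2) : Ord a 0 (waveInv D a).1 := by
  match a with
  | 0 => exact ((w.ord_right 0).mul ord_bhalfInv_zero).mono (by simp)
  | 1 => exact ((w.ord_right 1).mul ord_bhalfInv_one).mono (by simp)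

theorem inv_mul (a : Fin 2) : waveInv D a * S a = 1 :=
  mul_eq_one_comm_of_ord (w.ord_left a) (w.ord_inv a) (w.mul_inv a)

omit w in
theorem dual_eq (a : Fin 2) : D a = waveInv D a * bhalf a := by
  rw [waveInv, mul_assoc, bhalfInv_mul_bhalf, mul_one]

theorem laxOp_pow (a : Fin 2) (p : ℕ) :
    laxOp S D a ^ p = S a * lam a (sgn a * p) * waveInv D a := by
  induction p with
  | zero => rw [pow_zero, Nat.cast_zero, mul_zero, lam_zero, mul_one, w.mul_inv]
  | succ p ih =>
    have : S a * lam a (sgn a * p) * waveInv D a * (S a * lam a (sgn a) * waveInv D a) =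
        S a * lam a (sgn a * p) * (waveInv D a * S a) * lam a (sgn a) * waveInv D a := by
      simp only [mul_assoc]
    rw [pow_succ, ih, laxOp, this, w.inv_mul, mul_one, mul_assoc (S a), lam_mul_lam, Nat.cast_succ,
      mul_add, mul_one]

theorem laxOp_pow_mul (a : Fin 2) (p : ℕ) :
    laxOp S D a ^ p * S a = S a * lam a (sgn a * p) := by
  rw [w.laxOp_pow, mul_assoc, w.inv_mul, mul_one]

theorem inv_mul_laxOp_pow (a : Fin 2) (p : ℕ) :
    waveInv D a * laxOp S D a ^ p = lam a (sgn a * p) * waveInv D a := by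
  rw [w.laxOp_pow, ← mul_assoc, ← mul_assoc, w.inv_mul, one_mul]

theorem bderiv_left (i : Time) (a : Fin 2) : bderiv i (S a) = logDeriv S D i a * S a := by
  rw [logDeriv, mul_assoc, w.inv_mul, mul_one]

theorem bderiv_inv (i : Time) (a : Fin 2) :
    bderiv i (waveInv D a) = -(waveInv D a * logDeriv S D i a) := by
  have h := bderiv_mul i (S a) (waveInv D a)
  rw [w.mul_inv, bderiv_one, w.bderiv_left, mul_assoc, w.mul_inv, mul_one] at h
  have h2 : S a * bderiv i (waveInv D a) = -logDeriv S D i a := by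
    rw [eq_neg_iff_add_eq_zero, add_comm]; exact h.symm
  calc bderiv i (waveInv D a) = waveInv D a * (S a * bderiv i (waveInv D a)) := by
        rw [← mul_assoc, w.inv_mul, one_mul]
    _ = _ := by rw [h2, mul_neg]

theorem ord_logDeriv (i : Time) (a : Fin 2) : Ord a 0 (logDeriv S D i a).1 :=
  (((w.ord_left a).deriv i).mul (w.ord_inv a)).mono (add_zero 0).le

theorem ord_laxOp (a : Fin 2) : Ord a 1 (laxOp S D a).1 := by
  have h := ((w.ord_left a).mul (ord_shift a (sgn a))).mul (w.ord_inv a)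
  have hss : 0 + sgn a * sgn a + 0 = 1 := by fin_cases a <;> rfl
  rwa [hss] at h

/-- Powers of L commute with L, so the generator may replace ∂S S⁻¹ in the commutator. -/
theorem bderiv_laxOp (i : Time) (a : Fin 2) :
    bderiv i (laxOp S D a) =
      generator S D i a * laxOp S D a - laxOp S D a * generator S D i a := by
  have h : bderiv i (laxOp S D a) =
      logDeriv S D i a * laxOp S D a - laxOp S D a * logDeriv S D i a := by
    conv_lhs => rw [laxOp]
    rw [bderiv_mul, bderiv_mul, bderiv_lam, w.bderiv_left, w.bderiv_inv, laxOp]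
    simp only [mul_zero, add_zero, mul_neg, mul_assoc, sub_eq_add_neg]
  rw [h, generator]
  split_ifs
  · rw [add_mul, mul_add, ← pow_succ, ← pow_succ']
    abel
  · rw [add_zero]

/-- Differentiating S R = q · half trades S ∂R for -∂S R, and ∂S R = (∂S S⁻¹) q · half. The term S
Λ^{±p} R equals L^p q · half. -/
theorem firstOrder_left (i : Time) (a : Fin 2) (R : bounded a) (q : ℤ → TimeField)
    (hR : S a * R = bfn a q * bhalf a) :
    firstOrder i (S a) R =
      (bfn a (fun n => timeDeriv i (q n)) - generator S D i a * bfn a q) * bhalf a := by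
  have h1 : bderiv i (S a) * R + S a * bderiv i R =
      bfn a (fun n => timeDeriv i (q n)) * bhalf a := by
    rw [← bderiv_mul, hR, bderiv_mul, bderiv_bhalf, mul_zero, add_zero, bderiv_bfn]
  rw [w.bderiv_left, mul_assoc, hR] at h1
  rw [firstOrder, eq_sub_of_add_eq' h1, generator]
  split_ifs with hia
  · rw [← w.laxOp_pow_mul, mul_assoc _ (S a), hR]
    simp only [sub_mul, add_mul, mul_assoc]
    abel
  · simp only [sub_mul, add_zero, sub_zero, mul_assoc]

/-- Here the derivative falls on D = S⁻¹ · half, and R S⁻¹ = half · r · half⁻¹ moves the generator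
to the right of R. -/
theorem firstOrder_right (i : Time) (a : Fin 2) (R : bounded a) (r : ℤ → TimeField)
    (hR : R * D a = bhalf a * bfn a r) :
    firstOrder i R (D a) =
      -(bhalf a * (bfn a r * (bhalfInv a * (generator S D i a * bhalf a)))) := by
  have h1 : R * waveInv D a = bhalf a * (bfn a r * bhalfInv a) := by
    rw [waveInv, ← mul_assoc, hR, mul_assoc]
  have h2 : bderiv i (D a) = -(waveInv D a * logDeriv S D i a * bhalf a) := by
    conv_lhs => rw [dual_eq (D := D) a]
    rw [bderiv_mul, bderiv_bhalf, mul_zero, add_zero, w.bderiv_inv, neg_mul]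
  have h3 : firstOrder i R (D a) = -(R * waveInv D a * (generator S D i a * bhalf a)) := by
    rw [firstOrder, h2, generator]
    split_ifs with hia
    · have h4 : R * lam a (sgn a * i.2) * D a =
          R * waveInv D a * laxOp S D a ^ (i.2 : ℕ) * bhalf a := by
        rw [mul_assoc R (waveInv D a), w.inv_mul_laxOp_pow]
        conv_lhs => rw [dual_eq (D := D) a]
        simp only [mul_assoc]
      rw [h4]
      simp only [mul_add, add_mul, mul_neg, mul_assoc, neg_add, sub_eq_add_neg]
    · simp only [add_zero, sub_zero, mul_neg, mul_assoc]
  rw [h3, h1]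
  simp only [mul_assoc]

theorem generator_mul_half (i : Time) :
    (generator S D i 1 * bhalf 1).1 = -(generator S D i 0 * bhalf 0).1 := by
  have hf : ∀ a, firstOrder i (S a) (D a) = -(generator S D i a * bhalf a) := fun a => by
    have h := w.firstOrder_left i a (D a) (fun _ => 1)
      (by rw [w.mul_eq, bfn_const_one, one_mul])
    have h0 : bfn a (fun _ => timeDeriv i (1 : TimeField)) = 0 := by
      rw [← bderiv_bfn, bfn_const_one, bderiv_one]
    rw [h, h0, bfn_const_one, mul_one, zero_sub, neg_mul]
  ext k n
  have h := w.linear i k n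
  rw [hf, hf, coe_neg, coe_neg, neg_apply, neg_apply] at h
  rw [neg_apply]
  linear_combination -h

theorem generator_eq (i : Time) : (generator S D i 1).1 = (generator S D i 0).1 := by
  have h : ∀ a, generator S D i a = generator S D i a * bhalf a * bhalfInv a := fun a => by
    rw [mul_assoc, bhalf_mul_bhalfInv, mul_one]
  rw [h 0, h 1, coe_mul, coe_mul (generator S D i 0 * bhalf 0), w.generator_mul_half,
    coe_bhalfInv_one, neg_mul_neg']

theorem generator_eq' (i : Time) (a b : Fin 2) :
    (generator S D i a).1 = (generator S D i b).1 := by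
  have h := w.generator_eq i
  fin_cases a <;> fin_cases b <;> first | rfl | exact h | exact h.symm

theorem finsum_generator (i : Time) (n : ℤ) : ∑ᶠ k, (generator S D i 0).1 k n = 0 := by
  obtain ⟨_, h0⟩ := (generator S D i 0).2
  obtain ⟨_, h1⟩ := (generator S D i 1).2
  rw [w.generator_eq] at h1
  rw [← mul_half_add_apply h0 h1 0 n]
  have h := congrArg (fun A : ShiftOp => A 0 n) (w.generator_mul_half i)
  simp only [coe_mul, coe_bhalf, neg_apply, w.generator_eq] at h
  rw [h, add_neg_cancel]

/-- The generator is read off from the kind b other than that of the time, where it is ∂S S⁻¹ alone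
and has no terms in the leading direction of b. -/
theorem generator_apply_of_neg (i : Time) {k : ℤ} (hk : sgn i.1 * k < 0) (n : ℤ) :
    (generator S D i 0).1 k n = 0 := by
  have h : ∀ b, b ≠ i.1 → 0 < sgn b * k → (generator S D i 0).1 k n = 0 := fun b hb hbk => by
    rw [w.generator_eq' i 0 b, generator, if_neg hb.symm, add_zero]
    exact w.ord_logDeriv i b k n hbk
  revert hk
  match hi : i.1 with
  | 0 => exact fun hk => h 1 (by rw [hi]; simp) (by simp at hk ⊢; omega)
  | 1 => exact fun hk => h 0 (by rw [hi]; simp) (by simp at hk ⊢; omega)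

theorem generator_apply_of_pos (i : Time) {k : ℤ} (hk : 0 < sgn i.1 * k) (n : ℤ) :
    (generator S D i 0).1 k n = ((laxOp S D i.1).1 ^ (i.2 : ℕ)) k n := by
  rw [w.generator_eq' i 0 i.1, generator, if_pos rfl, coe_add, add_apply,
    w.ord_logDeriv i i.1 k n hk, zero_add, coe_pow]

theorem ord_laxOp_pow (a : Fin 2) (p : ℕ) : Ord a p ((laxOp S D a).1 ^ p) := by
  rw [← coe_pow]
  induction p with
  | zero => rw [pow_zero]; exact (ord_shift a 0).mono (by simp)
  | succ p ih =>
    rw [pow_succ, Nat.cast_succ]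
    exact ih.mul (w.ord_laxOp a)

/-- The generator has the three properties that characterize the truncation in `trunc_eq`. -/
theorem flow_eq (i : Time) :
    flow (laxOp S D 0).1 (laxOp S D 1).1 i.1 i.2 = (generator S D i 0).1 := by
  ext k n
  rw [← trunc_eq (w.ord_laxOp_pow i.1 i.2) (fun k n hk => w.generator_apply_of_neg i hk n)
    (w.finsum_generator i) (fun k n hk => w.generator_apply_of_pos i hk n) k n]
  match i with
  | (0, p) => simp [flow, truncDelta, delta]
  | (1, p) => simp [flow, truncDeltaStar, deltaStar]

theorem lax (i : Time) (a : Fin 2) : (laxOp S D a).1.deriv i =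
    comm (flow (laxOp S D 0).1 (laxOp S D 1).1 i.1 i.2) (laxOp S D a).1 := by
  rw [w.flow_eq, w.generator_eq' i 0 a]
  exact congrArg Subtype.val (w.bderiv_laxOp i a)

theorem isEigenfunction (R : ∀ a, bounded a) (q : ℤ → TimeField)
    (hR : ∀ a, S a * R a = bfn a q * bhalf a)
    (hlin : ∀ i k n, (firstOrder i (S 0) (R 0)).1 k n + (firstOrder i (S 1) (R 1)).1 k n = 0) :
    IsEigenfunction (laxOp S D 0).1 (laxOp S D 1).1 q := by
  intro a p n
  rw [w.flow_eq (a, p)]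
  have h := hlin (a, p) 0 n
  rw [w.firstOrder_left _ 0 _ q (hR 0), w.firstOrder_left _ 1 _ q (hR 1)] at h
  set G : ∀ b, bounded b := fun b =>
    bfn b (fun n => timeDeriv (a, p) (q n)) - generator S D (a, p) b * bfn b q with hG
  have hG1 : (G 1).1 = (G 0).1 := by
    simp only [hG, coe_sub, coe_mul, coe_bfn, w.generator_eq]
  obtain ⟨d, h0⟩ := (G 0).2
  obtain ⟨e, h1⟩ := (G 1).2
  -- The two G b are the same operator ∂q - B q, with B the flow. The first-order equation says that
  -- its coefficients sum to zero, which is ∂q - B(q) = 0.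
  change ((G 0).1 * half 0) 0 n + ((G 1).1 * half 1) 0 n = 0 at h
  rw [hG1] at h h1
  rw [mul_half_add_apply h0 h1] at h
  simp only [hG, coe_sub, coe_mul, coe_bfn, sub_apply, mul_fn_apply, fn_apply] at h
  obtain ⟨d, hd⟩ := (generator S D (a, p) 0).2
  obtain ⟨e, he⟩ := (generator S D (a, p) 1).2
  rw [w.generator_eq] at he
  rw [finsum_sub_distrib, finsum_eq_single _ 0 fun j hj => if_neg hj, if_pos rfl, sub_eq_zero] at h
  · exact h
  · refine (Set.finite_singleton (0 : ℤ)).subset fun j hj => ?_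
    by_contra hj0
    exact hj (if_neg hj0)
  · refine (Set.finite_Icc (-e) d).subset fun j hj => ?_
    have h2 := hd.le (left_ne_zero_of_mul hj)
    have h3 := he.le (left_ne_zero_of_mul hj)
    simp at h2 h3
    exact ⟨by omega, by omega⟩

end IsWave

/-! ## Adjoint eigenfunctions -/

theorem Ord.adj_zero {e : ℤ} {A : ShiftOp} (h : Ord 1 e A) : Ord 0 e A.adj := fun k n hk =>
  h (-k) (n + k) (by simpa using hk)

theorem Ord.adj_one {d : ℤ} {A : ShiftOp} (h : Ord 0 d A) : Ord 1 d A.adj := fun k n hk =>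
  h (-k) (n + k) (by simpa using hk)

/-- `Δ` as a bounded operator. -/
def bdelta (a : Fin 2) : bounded a := lam a 1 - 1

theorem coe_bdelta : (bdelta a).1 = delta := rfl

/-- The inverse of `Δ` among the bounded operators. -/
def binvDelta (a : Fin 2) : bounded a :=
  if a = 0 then bhalf a * lam a (-1) else -(bhalf a * lam a (-1))

theorem coe_binvDelta_zero : (binvDelta 0).1 = invDeltaDown := by
  ext k n
  rw [binvDelta, if_pos rfl, coe_mul, coe_bhalf, coe_lam, mul_shift_apply, half_zero_apply]
  change _ = if k ≤ -1 then 1 else 0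
  congr 1
  exact propext ⟨by omega, by omega⟩

theorem coe_binvDelta_one : (binvDelta 1).1 = invDeltaUp := by
  ext k n
  rw [binvDelta, if_neg (by simp), coe_neg, neg_apply, coe_mul, coe_bhalf, coe_lam,
    mul_shift_apply, half_one_apply]
  change _ = if 0 ≤ k then -1 else 0
  split_ifs <;> first | omega | simp

theorem binvDelta_mul_bdelta (a : Fin 2) : binvDelta a * bdelta a = 1 := by
  have h : lam a (-1) * bdelta a = 1 - lam a (-1) := by
    rw [bdelta, mul_sub, lam_mul_lam, mul_one, neg_add_cancel, lam_zero]
  have h2 := bhalf_mul_bhalfInv a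
  rw [binvDelta]
  unfold bhalfInv at h2
  split_ifs at h2 ⊢ with ha
  · rw [mul_assoc, h, h2]
  · rw [neg_mul, mul_assoc, h, ← mul_neg, neg_sub, h2]

/-- `Δ⁻¹ B^* Δ` for `B = E (1 - Λ⁻¹)`. -/
theorem conj_adj_apply {E B : ShiftOp} (hE : ∃ d, Ord a d E.adj)
    (hB : ∀ k n, B k n = E k n - E (k + 1) n) (k n : ℤ) :
    ((binvDelta a).1 * B.adj * delta) k n = E (-k) (n + k) - E (1 - k) (n + k - 1) := by
  set A : bounded a := ⟨E.adj, hE⟩ with hA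
  have h1 : B.adj = (-(bdelta a * A)).1 := by
    ext k n
    rw [bdelta, sub_mul, one_mul, coe_neg, coe_sub, neg_apply, sub_apply, coe_mul, coe_lam,
      shift_mul_apply]
    change B (-k) (n + k) = -(E (-(k - 1)) (n + 1 + (k - 1)) - E (-k) (n + k))
    rw [hB, show -(k - 1) = -k + 1 by ring, show n + 1 + (k - 1) = n + k by ring]
    ring
  have h2 : binvDelta a * -(bdelta a * A) * bdelta a = A - A * lam a 1 := by
    rw [mul_neg, ← mul_assoc, binvDelta_mul_bdelta, one_mul, bdelta, mul_sub, mul_one, neg_mul,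
      sub_neg_eq_add, neg_add_eq_sub]
  rw [h1, ← coe_bdelta (a := a), ← coe_mul, ← coe_mul, h2, coe_sub, sub_apply, coe_mul, coe_lam,
    mul_shift_apply]
  change E (-k) (n + k) - E (-(k - 1)) (n + (k - 1)) = _
  rw [show -(k - 1) = 1 - k by ring, show n + (k - 1) = n + k - 1 by ring]

namespace IsWave

variable {S D : ∀ a : Fin 2, bounded a} (w : IsWave S D)
include w

/-- With B the flow and E = B · half, B = E (1 - Λ⁻¹), so B^* = -Δ E^* and Δ⁻¹ B^* Δ = -E^* Δ. As E
is bounded on both sides, either expansion of Δ⁻¹ gives this result. The Λ^0 coefficient of the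
first-order equation is the action of this operator on r, up to sign. -/
theorem timeDeriv_adjoint (R : ∀ a, bounded a) (r : ℤ → TimeField)
    (hR : ∀ a, R a * D a = bhalf a * bfn a r)
    (hlin : ∀ i k n, (firstOrder i (R 0) (D 0)).1 k n + (firstOrder i (R 1) (D 1)).1 k n =
      timeDeriv i (r (n + k))) (i : Time) (n : ℤ) (b : Fin 2) :
    timeDeriv i (r n) = -((binvDelta b).1 *
      (flow (laxOp S D 0).1 (laxOp S D 1).1 i.1 i.2).adj * delta).act r n := by
  rw [w.flow_eq]
  set E := (generator S D i 0 * bhalf 0).1 with hE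
  obtain ⟨d, hd⟩ := (generator S D i 0 * bhalf 0).2
  obtain ⟨e, he⟩ := (-(generator S D i 1 * bhalf 1)).2
  rw [coe_neg, w.generator_mul_half, neg_neg] at he
  have hadj : ∃ d, Ord b d E.adj := by
    match b with
    | 0 => exact ⟨_, he.adj_zero⟩
    | 1 => exact ⟨_, hd.adj_one⟩
  have hB : ∀ k n, (generator S D i 0).1 k n = E k n - E (k + 1) n := fun k n => by
    have h : generator S D i 0 = generator S D i 0 * bhalf 0 * bhalfInv 0 := by
      rw [mul_assoc, bhalf_mul_bhalfInv, mul_one]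
    rw [h, bhalfInv, if_pos rfl, mul_sub, mul_one, coe_sub, sub_apply, coe_mul _ (lam 0 (-1)),
      coe_lam, mul_shift_apply, sub_neg_eq_add]
  set G : ∀ a, bounded a := fun a =>
    bfn a r * (bhalfInv a * (generator S D i a * bhalf a)) with hG
  have hG1 : (G 1).1 = (G 0).1 := by
    simp only [hG]
    rw [coe_mul, coe_mul (bhalfInv 1), w.generator_mul_half, coe_bhalfInv_one, neg_mul_neg']
    rfl
  have hG0 : ∀ k n, (G 0).1 k n = r n * (E k n - E (k + 1) (n - 1)) := fun k n => by
    have h2 : bhalfInv 0 * (generator S D i 0 * bhalf 0) =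
        generator S D i 0 * bhalf 0 - lam 0 (-1) * (generator S D i 0 * bhalf 0) := by
      rw [bhalfInv, if_pos rfl, sub_mul, one_mul]
    simp only [hG]
    rw [coe_mul, coe_bfn, fn_mul_apply, h2, coe_sub, sub_apply, coe_mul (lam 0 (-1)), coe_lam,
      shift_mul_apply, ← hE, sub_neg_eq_add, ← sub_eq_add_neg]
  have h := hlin i 0 n
  rw [w.firstOrder_right i 0 _ r (hR 0), w.firstOrder_right i 1 _ r (hR 1), add_zero] at h
  change (-(half 0 * (G 0).1)) 0 n + (-(half 1 * (G 1).1)) 0 n = _ at h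
  obtain ⟨_, h0⟩ := (G 0).2
  obtain ⟨_, h1⟩ := (G 1).2
  rw [hG1] at h h1
  rw [neg_apply, neg_apply, ← neg_add, half_mul_add_apply h0 h1] at h
  rw [← h]
  refine congrArg Neg.neg ?_
  refine finsum_congr fun j => ?_
  rw [conj_adj_apply hadj hB, hG0, zero_sub, neg_add_eq_sub]
  ring

theorem isAdjointEigenfunction (R : ∀ a, bounded a) (r : ℤ → TimeField)
    (hR : ∀ a, R a * D a = bhalf a * bfn a r)
    (hlin : ∀ i k n, (firstOrder i (R 0) (D 0)).1 k n + (firstOrder i (R 1) (D 1)).1 k n =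
      timeDeriv i (r (n + k))) :
    IsAdjointEigenfunction (laxOp S D 0).1 (laxOp S D 1).1 r := by
  intro a p n
  refine ⟨?_, ?_⟩
  · rw [← coe_binvDelta_one]
    exact w.timeDeriv_adjoint R r hR hlin (a, p) n 1
  · rw [← coe_binvDelta_zero]
    exact w.timeDeriv_adjoint R r hR hlin (a, p) n 0

end IsWave

/-! ## Tau functions -/

theorem waveOne_eq (τ₀ τ₁ : ℤ → TimeField) : waveOne τ₀ τ₁ = (dressLeft 0 τ₁ τ₀).1 := by
  ext k n
  rw [dressLeft, coe_mul, coe_bfn, fn_mul_apply]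
  change (if k ≤ 0 then _ else 0) = (τ₁ n)⁻¹ * (laurentShift 0 (-1) (τ₀ (n + 0))).coeff (-(1 * k))
  rw [add_zero, one_mul]
  split_ifs with hk
  · rw [laurentShift_coeff _ _ _ (by omega), div_eq_inv_mul]
  · rw [laurentShift_coeff_neg _ _ _ (by omega), mul_zero]

theorem waveTwo_eq (τ₀ τ₁ : ℤ → TimeField) : waveTwo τ₀ τ₁ = (dressLeft 1 τ₁ τ₀).1 := by
  ext k n
  rw [dressLeft, coe_mul, coe_bfn, fn_mul_apply]
  change (if 0 ≤ k then _ else 0) =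
    (τ₁ n)⁻¹ * (laurentShift 1 (-1) (τ₀ (n + 1))).coeff (-(-1 * k))
  rw [neg_one_mul, neg_neg]
  split_ifs with hk
  · rw [laurentShift_coeff _ _ _ hk, div_eq_inv_mul]
  · rw [laurentShift_coeff_neg _ _ _ (by omega), mul_zero]

theorem isWave_dress {τ₀ τ₁ : ℤ → TimeField} (hτ₀ : ∀ n, τ₀ n ≠ 0) (hτ₁ : ∀ n, τ₁ n ≠ 0)
    (h : IsTauPair τ₀ τ₁) :
    IsWave (fun a => dressLeft a τ₁ τ₀) (fun a => dressRight a τ₀ τ₁) where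
  ord_left a := ord_dressLeft a _ _
  ord_right a := ord_dressRight a _ _
  mul_eq a := by
    rw [dress_mul_dress h]
    simp only [div_self (hτ₀ _), div_self (hτ₁ _), bfn_const_one, one_mul, mul_one]
  linear i k n := by
    rw [firstOrder_add_apply h, div_self (hτ₀ _), Derivation.map_one_eq_zero, mul_zero]

theorem constraint_of_bilinear {m M N : ℕ} {τ₀ τ₁ : ℤ → TimeField}
    {ρ σ : Fin m → ℤ → TimeField}
    (w : IsWave (fun a => dressLeft a τ₁ τ₀) (fun a => dressRight a τ₀ τ₁))
    (h : ∀ n n' : ℤ, bilinear M N τ₀ τ₁ n n' = ∑ i, twoPoint (ρ i n) (σ i n')) :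
    (laxOp (fun a => dressLeft a τ₁ τ₀) (fun a => dressRight a τ₀ τ₁) 0).1 ^ M * invDeltaDown =
      (laxOp (fun a => dressLeft a τ₁ τ₀) (fun a => dressRight a τ₀ τ₁) 1).1 ^ N * invDeltaUp +
      ∑ i, bilateral (fun n => ρ i n / τ₁ n) (fun n => σ i (n + 1) / τ₀ (n + 1)) := by
  set S : ∀ a : Fin 2, bounded a := fun a => dressLeft a τ₁ τ₀ with hS
  set D : ∀ a : Fin 2, bounded a := fun a => dressRight a τ₀ τ₁ with hD
  have hL : ∀ a p, laxOp S D a ^ p * bhalf a =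
      dressLeft a τ₁ τ₀ * lam a (sgn a * (p : ℕ)) * dressRight a τ₀ τ₁ := fun a p => by
    rw [← w.mul_eq a, ← mul_assoc, w.laxOp_pow_mul]
  ext k n
  -- Right multiplication by Λ⁻¹ turns the halves into the expansions of Δ⁻¹, with a sign for the
  -- upper one, and shifts r by one; so the Λ^k coefficient corresponds to n' = n + k + 1.
  have hb := bilinear_coeff_zero M N τ₀ τ₁ (k + 1) n
  rw [h, map_sum] at hb
  simp only [twoPoint_coeff_zero] at hb
  have h0 := dress_mul_apply 0 τ₁ τ₀ τ₀ τ₁ (sgn 0 * M) (k + 1) n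
  have h1 := dress_mul_apply 1 τ₁ τ₀ τ₀ τ₁ (sgn 1 * N) (k + 1) n
  rw [← hL] at h0 h1
  have e0 : ((laxOp S D 0).1 ^ M * invDeltaDown) k n =
      (laxOp S D 0 ^ M * bhalf 0).1 (k + 1) n := by
    rw [← coe_binvDelta_zero, ← coe_pow, ← coe_mul, binvDelta, if_pos rfl, ← mul_assoc,
      coe_mul _ (lam 0 (-1)), coe_lam, mul_shift_apply, sub_neg_eq_add]
  have e1 : ((laxOp S D 1).1 ^ N * invDeltaUp) k n =
      -(laxOp S D 1 ^ N * bhalf 1).1 (k + 1) n := by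
    rw [← coe_binvDelta_one, ← coe_pow, ← coe_mul, binvDelta, if_neg (by simp), mul_neg,
      ← mul_assoc, coe_neg, neg_apply, coe_mul _ (lam 1 (-1)), coe_lam, mul_shift_apply,
      sub_neg_eq_add]
  rw [add_apply, e0, e1, h0, h1, sum_apply]
  have hsum : ∑ i, bilateral (fun n => ρ i n / τ₁ n) (fun n => σ i (n + 1) / τ₀ (n + 1)) k n =
      (τ₁ n)⁻¹ * (∑ i, ρ i n * σ i (n + (k + 1))) * (τ₀ (n + (k + 1)))⁻¹ := by
    rw [Finset.mul_sum, Finset.sum_mul]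
    refine Finset.sum_congr rfl fun i _ => ?_
    change ρ i n / τ₁ n * (σ i (n + k + 1) / τ₀ (n + k + 1)) = _
    rw [add_assoc]
    simp only [div_eq_mul_inv]
    ring
  rw [hsum, hb]
  ring

end ShiftOp

end GBMT

end

open GBMT GBMT.ShiftOp in
theorem mainTheorem3 (m M N : ℕ) (hM : 1 ≤ M) (hN : 1 ≤ N)
    (τ₀ τ₁ : ℤ → GBMT.TimeField) (ρ σ : Fin m → ℤ → GBMT.TimeField)
    (hτ₀ : ∀ n, τ₀ n ≠ 0) (hτ₁ : ∀ n, τ₁ n ≠ 0)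
    (h : GBMT.IsGBMT m M N τ₀ τ₁ ρ σ) :
    ∃ T₁ T₂ L₁ L₂ : GBMT.ShiftOp,
      GBMT.ShiftOp.IsInverseDown (GBMT.waveOne τ₀ τ₁) T₁ ∧
      GBMT.ShiftOp.IsInverseUp (GBMT.waveTwo τ₀ τ₁) T₂ ∧
      L₁ = GBMT.waveOne τ₀ τ₁ * GBMT.ShiftOp.shift 1 * T₁ ∧
      L₂ = GBMT.waveTwo τ₀ τ₁ * GBMT.ShiftOp.shift (-1) * T₂ ∧
      GBMT.ShiftOp.OrderLE L₁ 1 ∧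
      GBMT.ShiftOp.OrderGE L₂ (-1) ∧
      GBMT.IsGBMTLax m M N L₁ L₂
        (fun i n => ρ i n / τ₁ n) (fun i n => σ i n / τ₀ n) := by
  set S : ∀ a : Fin 2, bounded a := fun a => dressLeft a τ₁ τ₀ with hS
  set D : ∀ a : Fin 2, bounded a := fun a => dressRight a τ₀ τ₁ with hD
  have w : IsWave S D := isWave_dress hτ₀ hτ₁ h.pair
  rw [waveOne_eq, waveTwo_eq]
  refine ⟨(waveInv D 0).1, (waveInv D 1).1, (laxOp S D 0).1, (laxOp S D 1).1,
    ⟨⟨0, fun k n hk => w.ord_inv 0 k n (by simpa using hk)⟩,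
      congrArg Subtype.val (w.mul_inv 0), congrArg Subtype.val (w.inv_mul 0)⟩,
    ⟨⟨0, fun k n hk => w.ord_inv 1 k n (by simpa using hk)⟩,
      congrArg Subtype.val (w.mul_inv 1), congrArg Subtype.val (w.inv_mul 1)⟩,
    rfl, rfl, fun k n hk => w.ord_laxOp 0 k n (by simpa using hk),
    fun k n hk => w.ord_laxOp 1 k n (by rw [sgn_one]; omega), ?_, ?_, ?_, ?_⟩
  · exact constraint_of_bilinear w h.constraint
  · exact fun a p => ⟨w.lax (a, p) 0, w.lax (a, p) 1⟩
  · intro i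
    -- The right factor is still divided by τ₀, so that the right-hand side ρ(t) τ₀(t') becomes q ·
    -- 1 and its derivative in s vanishes.
    refine w.isEigenfunction (fun a => dressRight a τ₀ (ρ i)) _ (fun a => ?_) fun j k n => ?_
    · simp only [hS]
      rw [dress_mul_dress (h.pair_ρ i)]
      simp only [div_self (hτ₀ _), bfn_const_one, mul_one]
    · simp only [hS]
      rw [firstOrder_add_apply (h.pair_ρ i), div_self (hτ₀ _), Derivation.map_one_eq_zero,
        mul_zero]
  · intro i
    -- Dividing by τ₁ on the left and τ₀ on the right, the right-hand side τ₁(t) σ(t') becomes 1 ·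
    -- r, whose linear term in s is ∂r.
    refine w.isAdjointEigenfunction (fun a => dressLeft a τ₁ (σ i)) _ (fun a => ?_)
      fun j k n => ?_
    · simp only [hD]
      rw [dress_mul_dress (h.pair_σ i)]
      simp only [div_self (hτ₁ _), bfn_const_one, one_mul]
    · simp only [hD]
      rw [firstOrder_add_apply (h.pair_σ i), div_self (hτ₁ _), one_mul]
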